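/- Let $d\ge 2$, and let $g:[-1,1]\to[0,\infty)$ be measurable with $\int_{S^{d-1}} g(\omega\cdot n)\,dn=1$ for every $\omega\in S^{d-1}$ ($dn$ is the surface measure). Put $q=\int_{S^{d-1}} g(\omega\cdot n)\,(1-(\omega\cdot n)^2)\,dn$, which does not depend on $\omega\in S^{d-1}$. Let $\Phi$ be the set of functions $\varphi(k)=\int_{\mathbb R^d} e^{-ik\cdot v}f(dv)$, $k\in\mathbb R^d$, with $f$ a Borel probability measure on $\mathbb R^d$. For $\varphi\in\Phi$ let $$\Gamma[\varphi](k)=\int_{S^{d-1}} g\Big(\tfrac{k}{|k|}\cdot n\Big)\,\varphi(k_+)\,\varphi(k_-)\,dn,\qquad k_\pm=\tfrac12\big(k\pm|k|n\big),$$ with $\Gamma[\varphi](0)=\varphi(0)^2$. For $A\in M_{d\times d}(\mathbb R)$ let $\|A\|=\sup_{|k|=1}|Ak|$, and for $\beta\in\mathbb R$ let $A_\beta=A+\beta I$ and $(E_\beta(\tau)\psi)(k)=e^{-\tau}\psi(e^{-\tau A_\beta}k)$. For a symmetric $d\times d$ matrix $B=(b_{jl})$ and $p>2$ let $$\mathcal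 F_p(B)=\Big\{\Psi\in\Phi:\ \sup_{k\ne 0}\frac{\big|\Psi(k)-\big(1-\frac12\sum_{j,l}b_{jl}k_jk_l\big)\big|}{|k|^p}<\infty\Big\}.$$ **Theorem.** Let $p>2$. There exists $\varepsilon_0>0$, depending only on $d$, $g$ and $p$, such that for every real $d\times d$ matrix $A$ with $\|A\|\le\varepsilon_0$ the following holds. (i) Among the eigenvalues $\beta\in\mathbb C$ of the problem $$2\beta B+\big(BA+(BA)^T\big)+\frac{q\,d}{2(d-1)}\Big(B-\frac{\operatorname{Tr}B}{d}I\Big)=0,\qquad 0\ne B\in \mathrm{Symm}_{d\times d}(\mathbb C),$$ there is one, again denoted $\beta$, whose real part is strictly larger than that of every other eigenvalue; it is real and (algebraically) simple. It has an eigenvector $N$ which is a real symmetric, positive definite matrix, normalized by $\frac1d\operatorname{Tr}(N^TN)=1$. (ii) If moreover $2<p\le 4$, then, for these $\beta$ and $N$, the set $\mathcal F_p(N)$ is nonempty, and there exists a unique $\Psi\in\mathcal F_p(N)$ such that $$\Psi(k)=\int_0^\infty \big(E_\beta(\tau)\Gamma[\Psi]\big)(k)\,d\tau\qquad\text{for all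 }k\in\mathbb R^d.$$ -/

import Mathlib

open MeasureTheory

noncomputable section

namespace MaxwellDeformation

/-- Euclidean space `ℝ^d`. -/
abbrev E (d : ℕ) := EuclideanSpace ℝ (Fin d)

/-- The (unnormalised) surface measure on the unit sphere `S^{d-1}`. -/
abbrev sphereMeasure (d : ℕ) : Measure (Metric.sphere (0 : E d) 1) :=
  (volume : Measure (E d)).toSphere

/-- The first coordinate vector `(1, 0, …, 0)` of `ℝ^d`. -/
def e₁ (d : ℕ) : E d := WithLp.toLp 2 fun i : Fin d => if (i : ℕ) = 0 then 1 else 0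

/-- Admissible collision kernels: `g` is measurable and non-negative on `[-1, 1]`, and
`∫_{S^{d-1}} g(ω · n) dn = 1` for every unit vector `ω`.  (Values outside `[-1, 1]` play no role;
a Bochner integral with value `1` is the integral of an integrable function.) -/
structure IsCollisionKernel (d : ℕ) (g : ℝ → ℝ) : Prop where
  measurable : Measurable fun x : Set.Icc (-1 : ℝ) 1 => g x
  nonneg : ∀ x ∈ Set.Icc (-1 : ℝ) 1, 0 ≤ g x
  normalized : ∀ ω : E d, ‖ω‖ = 1 →
    ∫ n : Metric.sphere (0 : E d) 1, g (inner ℝ ω (n : E d)) ∂(sphereMeasure d) = 1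

/-- `q = ∫_{S^{d-1}} g(ω · n) (1 - (ω · n)²) dn`; the value is the same for every unit vector `ω`,
and is computed here at `ω = (1, 0, …, 0)`. -/
def kernelQ (d : ℕ) (g : ℝ → ℝ) : ℝ :=
  ∫ n : Metric.sphere (0 : E d) 1,
    g (inner ℝ (e₁ d) (n : E d)) * (1 - (inner ℝ (e₁ d) (n : E d)) ^ 2) ∂(sphereMeasure d)

/-- The set `Φ` of characteristic functions `k ↦ ∫ e^{-i k·v} f(dv)` of Borel probability
measures `f` on `ℝ^d`. -/
def charFunctions (d : ℕ) : Set (E d → ℂ) :=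
  {φ | ∃ f : Measure (E d), IsProbabilityMeasure f ∧
    ∀ k : E d, φ k = ∫ v, Complex.exp (-Complex.I * ((inner ℝ k v : ℝ) : ℂ)) ∂f}

/-- The gain operator
`Γ[φ](k) = ∫_{S^{d-1}} g(k/|k| · n) φ(k₊) φ(k₋) dn`, `k± = (k ± |k| n) / 2`.
At `k = 0`, where `k/|k|` is undefined, it has its limit value `φ(0)²` (recall that the kernel is
normalised). -/
def gain {d : ℕ} (g : ℝ → ℝ) (φ : E d → ℂ) (k : E d) : ℂ :=
  if k = 0 then φ 0 * φ 0
  else ∫ n : Metric.sphere (0 : E d) 1,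
    ((g (inner ℝ (‖k‖⁻¹ • k) (n : E d)) : ℝ) : ℂ) *
      (φ ((1 / 2 : ℝ) • (k + ‖k‖ • (n : E d))) * φ ((1 / 2 : ℝ) • (k - ‖k‖ • (n : E d))))
    ∂(sphereMeasure d)

/-- A matrix as a continuous linear map of Euclidean space; its operator norm is
`‖A‖ = sup_{|k| = 1} |A k|`. -/
abbrev toCLM {d : ℕ} (A : Matrix (Fin d) (Fin d) ℝ) : E d →L[ℝ] E d :=
  Matrix.toEuclideanCLM (𝕜 := ℝ) A

/-- `(E_β(τ) ψ)(k) = e^{-τ} ψ(e^{-τ A_β} k)` with `A_β = A + β I`. -/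
def semigroupE {d : ℕ} (A : Matrix (Fin d) (Fin d) ℝ) (β τ : ℝ) (ψ : E d → ℂ) (k : E d) : ℂ :=
  (Real.exp (-τ) : ℂ) * ψ (NormedSpace.exp (-(τ • toCLM (A + β • 1))) k)

/-- The stationary equation `Ψ(k) = ∫_0^∞ (E_β(τ) Γ[Ψ])(k) dτ` for all `k`. -/
def IsStationaryProfile {d : ℕ} (g : ℝ → ℝ) (A : Matrix (Fin d) (Fin d) ℝ) (β : ℝ)
    (Ψ : E d → ℂ) : Prop :=
  ∀ k : E d, Ψ k = ∫ τ in Set.Ioi (0 : ℝ), semigroupE A β τ (gain g Ψ) k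

/-- The class `F_p(B)`: characteristic functions `Ψ` with
`|Ψ(k) - (1 - ½ ∑ b_{jl} k_j k_l)| ≤ C |k|^p` for all `k`, for some constant `C`. -/
def classF {d : ℕ} (p : ℝ) (B : Matrix (Fin d) (Fin d) ℂ) : Set (E d → ℂ) :=
  {Ψ | Ψ ∈ charFunctions d ∧ ∃ C : ℝ, ∀ k : E d,
    ‖Ψ k - (1 - (1 / 2 : ℂ) * ∑ j, ∑ l, B j l * (k j : ℂ) * (k l : ℂ))‖ ≤ C * ‖k‖ ^ p}

/-- `Symm_{d×d}(ℂ)`, the complex symmetric matrices. -/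
def symmMatrices (d : ℕ) : Submodule ℂ (Matrix (Fin d) (Fin d) ℂ) where
  carrier := {B | B.IsSymm}
  add_mem' ha hb := ha.add hb
  zero_mem' := Matrix.isSymm_zero
  smul_mem' c _ hB := hB.smul c

/-- The linear map
`B ↦ (B A + (B A)ᵀ) + (q d / (2 (d - 1))) (B - (Tr B / d) I)` on complex matrices. -/
def momentMap {d : ℕ} (g : ℝ → ℝ) (A : Matrix (Fin d) (Fin d) ℝ) :
    Matrix (Fin d) (Fin d) ℂ →ₗ[ℂ] Matrix (Fin d) (Fin d) ℂ where
  toFun B := (B * A.map Complex.ofReal + (B * A.map Complex.ofReal).transpose) +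
    ((kernelQ d g : ℂ) * d / (2 * (d - 1))) • (B - (B.trace / d) • 1)
  map_add' B B' := by
    simp only [Matrix.add_mul, Matrix.transpose_add, Matrix.trace_add, add_div, add_smul,
      smul_add, smul_sub]
    abel
  map_smul' c B := by
    simp only [Matrix.smul_mul, Matrix.transpose_smul, Matrix.trace_smul, RingHom.id_apply,
      smul_add, smul_sub, smul_eq_mul, mul_div_assoc, mul_smul]
    simp only [smul_smul]
    congr 3 <;> ring_nf

/-- The eigenvalue problem
`2 β B + (B A + (B A)ᵀ) + (q d / (2 (d - 1))) (B - (Tr B / d) I) = 0`. -/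
def SolvesMomentProblem {d : ℕ} (g : ℝ → ℝ) (A : Matrix (Fin d) (Fin d) ℝ) (β : ℂ)
    (B : Matrix (Fin d) (Fin d) ℂ) : Prop :=
  (2 * β) • B + momentMap g A B = 0

/-- `β` is an eigenvalue: the problem has a non-zero complex symmetric solution. -/
def IsMomentEigenvalue {d : ℕ} (g : ℝ → ℝ) (A : Matrix (Fin d) (Fin d) ℝ) (β : ℂ) : Prop :=
  ∃ B : Matrix (Fin d) (Fin d) ℂ, B.IsSymm ∧ B ≠ 0 ∧ SolvesMomentProblem g A β B

theorem momentMap_mem {d : ℕ} (g : ℝ → ℝ) (A : Matrix (Fin d) (Fin d) ℝ) :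
    ∀ B ∈ symmMatrices d, (-(1 / 2 : ℂ) • momentMap g A) B ∈ symmMatrices d := by
  intro B hB
  have hB' : B.transpose = B := hB
  refine (symmMatrices d).smul_mem _ ?_
  change Matrix.transpose _ = _
  simp only [momentMap, LinearMap.coe_mk, AddHom.coe_mk, Matrix.transpose_add,
    Matrix.transpose_transpose, Matrix.transpose_smul, Matrix.transpose_sub, hB',
    Matrix.transpose_one]
  abel

/-- The endomorphism `-½ momentMap` of `Symm_{d×d}(ℂ)`; the eigenvalue problem above says exactly
that `B` is an eigenvector of it for `β` (see `hasEigenvalue_momentOperator_iff`). -/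
def momentOperator {d : ℕ} (g : ℝ → ℝ) (A : Matrix (Fin d) (Fin d) ℝ) :
    Module.End ℂ (symmMatrices d) :=
  (-(1 / 2 : ℂ) • momentMap g A).restrict (momentMap_mem g A)

theorem momentOperator_apply_eq_iff {d : ℕ} (g : ℝ → ℝ) (A : Matrix (Fin d) (Fin d) ℝ) (β : ℂ)
    (B : symmMatrices d) :
    momentOperator g A B = β • B ↔ SolvesMomentProblem g A β (B : Matrix (Fin d) (Fin d) ℂ) := by
  rw [← Subtype.coe_inj]
  change (-(1 / 2 : ℂ)) • momentMap g A (B : Matrix (Fin d) (Fin d) ℂ) = β • (B : Matrix _ _ ℂ) ↔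
    (2 * β) • (B : Matrix (Fin d) (Fin d) ℂ) + momentMap g A (B : Matrix (Fin d) (Fin d) ℂ) = 0
  constructor
  · intro h
    rw [mul_smul, ← h, smul_smul]
    norm_num
  · intro h
    rw [eq_neg_of_add_eq_zero_right h, smul_neg, smul_smul, ← neg_smul]
    congr 1
    ring

theorem hasEigenvalue_momentOperator_iff {d : ℕ} (g : ℝ → ℝ) (A : Matrix (Fin d) (Fin d) ℝ)
    (β : ℂ) : (momentOperator g A).HasEigenvalue β ↔ IsMomentEigenvalue g A β := by
  constructor
  · intro h
    obtain ⟨B, hB⟩ := h.exists_hasEigenvector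
    exact ⟨B, B.2, fun h0 => hB.2 (Subtype.ext h0),
      (momentOperator_apply_eq_iff g A β B).1 hB.apply_eq_smul⟩
  · rintro ⟨B, hs, h0, hB⟩
    refine Module.End.hasEigenvalue_of_hasEigenvector (x := (⟨B, hs⟩ : symmMatrices d)) ⟨?_, ?_⟩
    · exact Module.End.mem_eigenspace_iff.2 ((momentOperator_apply_eq_iff g A β ⟨B, hs⟩).2 hB)
    · exact fun h => h0 (congrArg Subtype.val h)

/-- `β` is a simple eigenvalue: its algebraic multiplicity, i.e. the dimension of its generalised
eigenspace in `Symm_{d×d}(ℂ)`, is one. -/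
def IsSimpleMomentEigenvalue {d : ℕ} (g : ℝ → ℝ) (A : Matrix (Fin d) (Fin d) ℝ) (β : ℂ) : Prop :=
  IsMomentEigenvalue g A β ∧
    Module.finrank ℂ ((momentOperator g A).maxGenEigenspace β) = 1

end MaxwellDeformation

end

/-!
# Self-similar profiles for the Boltzmann equation with small linear deformation

The eigenvalue problem is a small perturbation of the case `A = 0`, in which `β = 0` belongs to the
identity matrix and all traceless matrices share the eigenvalue `-K / 2` with
`K = q d / (2 (d - 1)) > 0`. Writing an eigenvector as `1 + X` with `X` traceless, the trace of the
equation gives `β` in terms of `X`, and the remaining equation is a contraction for `X`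
(`exists_traceless_perturbation`). Dominance and simplicity follow from one estimate
(`eq_zero_of_traceless`, `IsDominantPair.exists_eq_smul`): if `Re μ ≥ β`, every solution `B` of
`(momentMap + 2 μ) B = c N` is a multiple of `N`, which excludes other eigenvalues with
`Re μ ≥ β` as well as a Jordan block at `β`.

The stationary equation is the fixed point equation of
`T Ψ = ∫_0^∞ e^{-τ} Γ[Ψ](e^{-τ A_β} ·) dτ`, which is a contraction for the distance
`sup_k |φ(k) - ψ(k)| / |k|^p` when `p > 2` and `A` is small:

* `T` preserves characteristic functions. For `Γ` this is the classical computation of the Fourier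
  transform of the collision operator (`gain_mem_charFunctions`), which rests on the rotation
  invariance of the surface measure (`integral_kernelMeasure_direction_swap`); the integral over `τ`
  is a mixture of linear images (`evolve_mem_charFunctions`).
* Since `|k₊|² + |k₋|² = |k|²`, the operator `Γ` contracts by the average of
  `a^{p/2} + (1 - a)^{p/2}` with `a = (1 + ω · n) / 2`, which is less than one
  (`contractionFactor_lt_one`, `norm_gain_sub_le`), and the flow costs only the factor
  `1 / (1 - p ‖A_β‖)` (`norm_evolve_sub_le`).
* For `2 < p ≤ 4` the class `F_p(N)` consists of the characteristic functions at finite distance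
  from the Gaussian with covariance `N` (`mem_classF_iff_gaussian`). The operator `T` moves this
  Gaussian by a finite distance: `Γ` turns `1 - ½ N` into `1 - ½ (N + N A_β + (N A_β)ᵀ)`, which is
  the moment problem (`norm_gain_gaussian_sub_le`, `gainMatrix_eq`), and the integral over `τ` turns
  the latter back into `1 - ½ N` (`evolve_one_sub_quadForm`).
* The set of characteristic functions at finite distance from the Gaussian is complete by Lévy's
  theorem and Prokhorov's theorem (`mem_charFunctions_of_tendsto`).
-/

namespace MaxwellDeformation

/-! ### The surface measure of the unit sphere -/

section Sphere

variable {d : ℕ}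

/-- The action of a linear isometry of `ℝ^d` on the unit sphere. -/
noncomputable def sphereIsometry (L : E d ≃ₗᵢ[ℝ] E d) (n : Metric.sphere (0 : E d) 1) :
    Metric.sphere (0 : E d) 1 :=
  ⟨L n, by simp⟩

@[simp]
theorem coe_sphereIsometry (L : E d ≃ₗᵢ[ℝ] E d) (n : Metric.sphere (0 : E d) 1) :
    (sphereIsometry L n : E d) = L n := rfl

theorem continuous_sphereIsometry (L : E d ≃ₗᵢ[ℝ] E d) : Continuous (sphereIsometry L) :=
  (L.continuous.comp continuous_subtype_val).subtype_mk _

open scoped Pointwise in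
theorem measurePreserving_sphereIsometry (L : E d ≃ₗᵢ[ℝ] E d) :
    MeasurePreserving (sphereIsometry L) (sphereMeasure d) (sphereMeasure d) := by
  refine ⟨(continuous_sphereIsometry L).measurable, Measure.ext fun s hs => ?_⟩
  have hm := (continuous_sphereIsometry L).measurable
  rw [Measure.map_apply hm hs, Measure.toSphere_apply' _ hs, Measure.toSphere_apply' _ (hm hs)]
  congr 1
  rw [← (L.measurePreserving).measure_preimage_equiv
    (f := L.toHomeomorph.toMeasurableEquiv) (Set.Ioo (0 : ℝ) 1 • (Subtype.val '' s))]
  congr 1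
  ext x
  simp only [Set.mem_smul, Set.mem_image, Set.mem_preimage]
  constructor
  · rintro ⟨r, hr, _, ⟨n, hn, rfl⟩, rfl⟩
    exact ⟨r, hr, _, ⟨_, hn, rfl⟩, by simp⟩
  · rintro ⟨r, hr, _, ⟨n, hn, rfl⟩, hx⟩
    refine ⟨r, hr, _, ⟨sphereIsometry L.symm n, ?_, rfl⟩, ?_⟩
    · have : sphereIsometry L (sphereIsometry L.symm n) = n := by ext1; simp
      rwa [this]
    · apply L.injective
      simpa using hx

open scoped Pointwise in
/-- A line meets the sphere in a null set, because the cone over this set lies in the line. -/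
theorem sphereMeasure_span_eq_zero (hd : 2 ≤ d) (w : E d) :
    sphereMeasure d {n : Metric.sphere (0 : E d) 1 | (n : E d) ∈ Submodule.span ℝ {w}} = 0 := by
  have hne : Submodule.span ℝ {w} ≠ ⊤ := by
    intro h
    have h1 : Module.finrank ℝ (Submodule.span ℝ {w}) ≤ 1 := by
      simpa using finrank_span_le_card ({w} : Set (E d))
    rw [h, finrank_top, finrank_euclideanSpace_fin] at h1
    omega
  have hmeas : MeasurableSet {n : Metric.sphere (0 : E d) 1 | (n : E d) ∈ Submodule.span ℝ {w}} :=
    measurable_subtype_coe (Submodule.closed_of_finiteDimensional _).measurableSet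
  rw [Measure.toSphere_apply' _ hmeas]
  refine mul_eq_zero_of_right _ (measure_mono_null ?_ (Measure.addHaar_submodule volume _ hne))
  rintro _ ⟨r, -, _, ⟨n, hn, rfl⟩, rfl⟩
  exact Submodule.smul_mem _ _ hn

theorem norm_coe_sphere (n : Metric.sphere (0 : E d) 1) : ‖(n : E d)‖ = 1 := by simp

theorem inner_sphere_mem_Icc {w : E d} (hw : ‖w‖ = 1) (n : Metric.sphere (0 : E d) 1) :
    inner ℝ w (n : E d) ∈ Set.Icc (-1 : ℝ) 1 := by
  have h := abs_real_inner_le_norm w (n : E d)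
  rw [hw, norm_coe_sphere, mul_one] at h
  exact abs_le.1 h

/-- Almost every unit vector is not parallel to a given one. -/
theorem ae_inner_sq_lt_one (hd : 2 ≤ d) {w : E d} (hw : ‖w‖ = 1) :
    ∀ᵐ n : Metric.sphere (0 : E d) 1 ∂(sphereMeasure d), inner ℝ w (n : E d) ^ 2 < 1 := by
  rw [ae_iff]
  refine measure_mono_null (fun n hn => ?_) (sphereMeasure_span_eq_zero hd w)
  have h1 := inner_sphere_mem_Icc hw n
  have h2 : |inner ℝ w (n : E d)| = ‖w‖ * ‖(n : E d)‖ := by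
    rw [hw, norm_coe_sphere, mul_one]
    have h3 : ¬ inner ℝ w (n : E d) ^ 2 < 1 := hn
    rw [sq_lt_one_iff_abs_lt_one, not_lt] at h3
    exact le_antisymm (abs_le.2 h1) h3
  have h4 := (abs_real_inner_div_norm_mul_norm_eq_one_iff w (n : E d)).1
    (by rw [abs_div, h2, hw, norm_coe_sphere]; simp)
  obtain ⟨-, r, -, hr⟩ := h4
  exact Submodule.mem_span_singleton.2 ⟨r, hr.symm⟩

end Sphere

/-! ### Averages against the collision kernel -/

section Kernel

variable {d : ℕ} {g : ℝ → ℝ}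

/-- The probability measure `g(w · n) dn` on the unit sphere, for a unit vector `w`. -/
noncomputable def kernelMeasure (g : ℝ → ℝ) (w : E d) : Measure (Metric.sphere (0 : E d) 1) :=
  (sphereMeasure d).withDensity fun n => ((g (inner ℝ w (n : E d))).toNNReal : ENNReal)

theorem IsCollisionKernel.measurable_comp_inner (hg : IsCollisionKernel d g) {w : E d}
    (hw : ‖w‖ = 1) :
    Measurable fun n : Metric.sphere (0 : E d) 1 => g (inner ℝ w (n : E d)) := by
  have h : Measurable fun n : Metric.sphere (0 : E d) 1 =>
      (⟨inner ℝ w (n : E d), inner_sphere_mem_Icc hw n⟩ : Set.Icc (-1 : ℝ) 1) :=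
    Measurable.subtype_mk (by fun_prop)
  exact hg.measurable.comp h

theorem IsCollisionKernel.nonneg_inner (hg : IsCollisionKernel d g) {w : E d}
    (hw : ‖w‖ = 1) (n : Metric.sphere (0 : E d) 1) : 0 ≤ g (inner ℝ w (n : E d)) :=
  hg.nonneg _ (inner_sphere_mem_Icc hw n)

theorem IsCollisionKernel.integrable (hg : IsCollisionKernel d g) {w : E d} (hw : ‖w‖ = 1) :
    Integrable (fun n : Metric.sphere (0 : E d) 1 => g (inner ℝ w (n : E d)))
      (sphereMeasure d) :=
  Integrable.of_integral_ne_zero (by rw [hg.normalized w hw]; exact one_ne_zero)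

theorem IsCollisionKernel.isProbabilityMeasure (hg : IsCollisionKernel d g) {w : E d}
    (hw : ‖w‖ = 1) : IsProbabilityMeasure (kernelMeasure g w) := by
  constructor
  rw [kernelMeasure, withDensity_apply _ MeasurableSet.univ, Measure.restrict_univ]
  have h := ofReal_integral_eq_lintegral_ofReal (hg.integrable hw)
    (Filter.Eventually.of_forall (hg.nonneg_inner hw))
  rw [hg.normalized w hw, ENNReal.ofReal_one] at h
  exact h.symm

theorem IsCollisionKernel.integral_kernelMeasure {F : Type*} [NormedAddCommGroup F]
    [NormedSpace ℝ F] (hg : IsCollisionKernel d g) {w : E d} (hw : ‖w‖ = 1)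
    (f : Metric.sphere (0 : E d) 1 → F) :
    ∫ n, f n ∂(kernelMeasure g w) =
      ∫ n, g (inner ℝ w (n : E d)) • f n ∂(sphereMeasure d) := by
  rw [kernelMeasure, integral_withDensity_eq_integral_smul
    (hg.measurable_comp_inner hw).real_toNNReal]
  refine integral_congr_ae (Filter.Eventually.of_forall fun n => ?_)
  simp only [NNReal.smul_def, Real.coe_toNNReal _ (hg.nonneg_inner hw n)]

/-- Rotations of the sphere transport the kernel measure of `w` to that of the rotated vector. -/
theorem integral_kernelMeasure_map (L : E d ≃ₗᵢ[ℝ] E d) (w : E d) (hg : IsCollisionKernel d g)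
    (hw : ‖w‖ = 1) {F : Type*} [NormedAddCommGroup F] [NormedSpace ℝ F]
    (f : Metric.sphere (0 : E d) 1 → F) :
    ∫ n, f n ∂(kernelMeasure g (L w)) = ∫ n, f (sphereIsometry L n) ∂(kernelMeasure g w) := by
  have he : MeasurableEmbedding (sphereIsometry L) := by
    refine (Topology.IsClosedEmbedding.of_continuous_injective_isClosedMap
      (continuous_sphereIsometry L) (fun a b h => ?_)
      (continuous_sphereIsometry L).isClosedMap).measurableEmbedding
    exact Subtype.ext (L.injective (congrArg Subtype.val h))
  rw [hg.integral_kernelMeasure (by simpa using hw), hg.integral_kernelMeasure hw,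
    ← (measurePreserving_sphereIsometry L).integral_comp he]
  simp

/-- The reflection exchanging two unit vectors `v` and `w` exchanges their roles in averages against
the kernel. In particular the average of a function of `w · n` does not depend on `w`. -/
theorem integral_kernelMeasure_inner_eq (hg : IsCollisionKernel d g) {v w : E d} (hv : ‖v‖ = 1)
    (hw : ‖w‖ = 1) {F : Type*} [NormedAddCommGroup F] [NormedSpace ℝ F] (f : ℝ → ℝ → F) :
    ∫ n, f (inner ℝ v (n : E d)) (inner ℝ w (n : E d)) ∂(kernelMeasure g v) =
      ∫ n, f (inner ℝ w (n : E d)) (inner ℝ v (n : E d)) ∂(kernelMeasure g w) := by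
  set L : E d ≃ₗᵢ[ℝ] E d := (Submodule.span ℝ {v - w})ᗮ.reflection with hL
  have h1 : L v = w := Submodule.reflection_sub (hv.trans hw.symm)
  have h2 : L w = v := by rw [← h1]; exact Submodule.reflection_reflection _ v
  rw [← h2, integral_kernelMeasure_map L w hg hw]
  refine integral_congr_ae (Filter.Eventually.of_forall fun n => ?_)
  have h3 : inner ℝ w (L n) = inner ℝ (L w) (n : E d) := by
    rw [← LinearIsometryEquiv.inner_map_map L, hL, Submodule.reflection_reflection]
  simp only [coe_sphereIsometry, LinearIsometryEquiv.inner_map_map, h3]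

theorem norm_e₁ (hd : 2 ≤ d) : ‖e₁ d‖ = 1 := by
  have : e₁ d = EuclideanSpace.single (⟨0, by omega⟩ : Fin d) (1 : ℝ) := by
    ext i
    simp [e₁, Fin.ext_iff]
  rw [this]; simp

theorem integrable_of_continuous_sphere {F : Type*} [NormedAddCommGroup F]
    (μ : Measure (Metric.sphere (0 : E d) 1)) [IsFiniteMeasure μ]
    {f : Metric.sphere (0 : E d) 1 → F} (hf : Continuous f) : Integrable f μ :=
  hf.integrable_of_hasCompactSupport (HasCompactSupport.of_compactSpace f)

/-- A function of `w · n` that is positive for `|w · n| < 1` has positive average. -/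
theorem integral_kernelMeasure_pos (hd : 2 ≤ d) (hg : IsCollisionKernel d g) {w : E d}
    (hw : ‖w‖ = 1) {f : ℝ → ℝ} (hf : Continuous f) (h0 : ∀ x ∈ Set.Icc (-1 : ℝ) 1, 0 ≤ f x)
    (h1 : ∀ x : ℝ, x ^ 2 < 1 → 0 < f x) :
    0 < ∫ n, f (inner ℝ w (n : E d)) ∂(kernelMeasure g w) := by
  have := hg.isProbabilityMeasure hw
  have hae : ∀ᵐ n : Metric.sphere (0 : E d) 1 ∂(kernelMeasure g w), 0 < f (inner ℝ w (n : E d)) :=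
    (withDensity_absolutelyContinuous _ _).ae_le
      ((ae_inner_sq_lt_one hd hw).mono fun n hn => h1 _ hn)
  have hint : Integrable (fun n : Metric.sphere (0 : E d) 1 => f (inner ℝ w (n : E d)))
      (kernelMeasure g w) := integrable_of_continuous_sphere _ (by fun_prop)
  rw [integral_pos_iff_support_of_nonneg (fun n => h0 _ (inner_sphere_mem_Icc hw n)) hint]
  have hsupp : ∀ᵐ n ∂(kernelMeasure g w),
      n ∈ Function.support fun n : Metric.sphere (0 : E d) 1 => f (inner ℝ w (n : E d)) :=
    hae.mono fun n hn => hn.ne'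
  have h := measure_congr (Filter.eventuallyEq_univ.2 hsupp)
  rw [measure_univ] at h
  exact h ▸ one_pos

theorem kernelQ_eq (hd : 2 ≤ d) (hg : IsCollisionKernel d g) {w : E d} (hw : ‖w‖ = 1) :
    kernelQ d g = ∫ n, (1 - inner ℝ w (n : E d) ^ 2) ∂(kernelMeasure g w) := by
  rw [← integral_kernelMeasure_inner_eq hg (norm_e₁ hd) hw (fun x _ => 1 - x ^ 2),
    hg.integral_kernelMeasure (norm_e₁ hd)]
  rfl

theorem kernelQ_pos (hd : 2 ≤ d) (hg : IsCollisionKernel d g) : 0 < kernelQ d g := by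
  rw [kernelQ_eq hd hg (norm_e₁ hd)]
  refine integral_kernelMeasure_pos hd hg (norm_e₁ hd) (f := fun x => 1 - x ^ 2) (by fun_prop)
    (fun x hx => ?_) (fun x hx => by linarith)
  have := abs_le.2 hx
  have := (sq_le_one_iff_abs_le_one x).2 this
  linarith

end Kernel

/-! ### Second moments of the collision kernel -/

section Moments

variable {d : ℕ} {g : ℝ → ℝ}

theorem kernelMeasure_comp_of_fixed (hg : IsCollisionKernel d g) {w : E d} (hw : ‖w‖ = 1)
    (L : E d ≃ₗᵢ[ℝ] E d) (hL : L w = w) {F : Type*} [NormedAddCommGroup F] [NormedSpace ℝ F]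
    (f : Metric.sphere (0 : E d) 1 → F) :
    ∫ n, f n ∂(kernelMeasure g w) = ∫ n, f (sphereIsometry L n) ∂(kernelMeasure g w) := by
  conv_lhs => rw [← hL]
  exact integral_kernelMeasure_map L w hg hw f

theorem reflection_orthogonal_span_of_inner_eq_zero {v w : E d} (h : inner ℝ v w = 0) :
    (Submodule.span ℝ {v})ᗮ.reflection w = w :=
  Submodule.reflection_mem_subspace_eq_self
    (Submodule.mem_orthogonal_singleton_iff_inner_right.2 h)

/-- Mixed moments vanish, by the reflection that fixes `w` and changes the sign of `u`. -/
theorem integral_inner_mul_inner_eq_zero (hg : IsCollisionKernel d g) {w u : E d} (hw : ‖w‖ = 1)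
    (hu : inner ℝ u w = 0) :
    ∫ n, inner ℝ w (n : E d) * inner ℝ u (n : E d) ∂(kernelMeasure g w) = 0 := by
  set L : E d ≃ₗᵢ[ℝ] E d := (Submodule.span ℝ {u})ᗮ.reflection with hL
  have h1 : L w = w := reflection_orthogonal_span_of_inner_eq_zero hu
  have h2 : L u = -u := Submodule.reflection_orthogonalComplement_singleton_eq_neg u
  have hs : ∀ x y : E d, inner ℝ x (L y) = inner ℝ (L x) y := fun x y => by
    rw [← LinearIsometryEquiv.inner_map_map L, hL, Submodule.reflection_reflection]
  have h := kernelMeasure_comp_of_fixed hg hw L h1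
    fun n => inner ℝ w (n : E d) * inner ℝ u (n : E d)
  simp only [coe_sphereIsometry, hs, h1, h2, inner_neg_left, mul_neg, integral_neg] at h
  linarith

theorem integral_inner_sq_eq_of_norm_eq (hg : IsCollisionKernel d g) {w u v : E d}
    (hw : ‖w‖ = 1) (hu : inner ℝ u w = 0) (hv : inner ℝ v w = 0) (huv : ‖u‖ = ‖v‖) :
    ∫ n, inner ℝ u (n : E d) ^ 2 ∂(kernelMeasure g w) =
      ∫ n, inner ℝ v (n : E d) ^ 2 ∂(kernelMeasure g w) := by
  set L : E d ≃ₗᵢ[ℝ] E d := (Submodule.span ℝ {u - v})ᗮ.reflection with hL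
  have h1 : L w = w :=
    reflection_orthogonal_span_of_inner_eq_zero (by rw [inner_sub_left, hu, hv, sub_zero])
  have h2 : L u = v := Submodule.reflection_sub huv
  have hs : ∀ x y : E d, inner ℝ x (L y) = inner ℝ (L x) y := fun x y => by
    rw [← LinearIsometryEquiv.inner_map_map L, hL, Submodule.reflection_reflection]
  have h := kernelMeasure_comp_of_fixed hg hw L h1 fun n => inner ℝ u (n : E d) ^ 2
  simpa only [coe_sphereIsometry, hs, h2] using h

/-- On the hyperplane orthogonal to `w` the second moment form is a multiple of the square of the
norm, by rotation invariance. -/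
theorem exists_integral_inner_sq_orthogonal (hg : IsCollisionKernel d g) {w : E d}
    (hw : ‖w‖ = 1) :
    ∃ b : ℝ, ∀ u : E d, inner ℝ u w = 0 →
      ∫ n, inner ℝ u (n : E d) ^ 2 ∂(kernelMeasure g w) = b * ‖u‖ ^ 2 := by
  by_cases h : ∃ v : E d, inner ℝ v w = 0 ∧ v ≠ 0
  · obtain ⟨v, hv, hv0⟩ := h
    have hn : ‖v‖ ≠ 0 := norm_ne_zero_iff.2 hv0
    refine ⟨(∫ n, inner ℝ v (n : E d) ^ 2 ∂(kernelMeasure g w)) / ‖v‖ ^ 2, fun u hu => ?_⟩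
    rw [integral_inner_sq_eq_of_norm_eq hg hw hu (v := (‖u‖ / ‖v‖) • v)
      (by rw [real_inner_smul_left, hv, mul_zero])
      (by rw [norm_smul, norm_div, norm_norm, norm_norm, div_mul_cancel₀ _ hn])]
    simp only [real_inner_smul_left, mul_pow, integral_const_mul]
    field_simp
  · push Not at h
    exact ⟨0, fun u hu => by simp [h u hu]⟩

theorem integral_inner_sq_self (hd : 2 ≤ d) (hg : IsCollisionKernel d g) {w : E d}
    (hw : ‖w‖ = 1) :
    ∫ n, inner ℝ w (n : E d) ^ 2 ∂(kernelMeasure g w) = 1 - kernelQ d g := by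
  have := hg.isProbabilityMeasure hw
  rw [kernelQ_eq hd hg hw, integral_sub (integrable_const _)
    (integrable_of_continuous_sphere _ (by fun_prop))]
  simp

/-- The second moment form of the probability measure `g(w · n) dn`. -/
theorem integral_inner_sq (hd : 2 ≤ d) (hg : IsCollisionKernel d g) {w : E d} (hw : ‖w‖ = 1)
    (u : E d) :
    ∫ n, inner ℝ u (n : E d) ^ 2 ∂(kernelMeasure g w) =
      (1 - kernelQ d g - kernelQ d g / (d - 1)) * inner ℝ w u ^ 2 +
        kernelQ d g / (d - 1) * ‖u‖ ^ 2 := by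
  have := hg.isProbabilityMeasure hw
  obtain ⟨b, hb⟩ := exists_integral_inner_sq_orthogonal hg hw
  -- Split `u` into its components along `w` and orthogonal to `w`.
  have key : ∀ u : E d, ∫ n, inner ℝ u (n : E d) ^ 2 ∂(kernelMeasure g w) =
      (1 - kernelQ d g - b) * inner ℝ w u ^ 2 + b * ‖u‖ ^ 2 := by
    intro u
    set c := inner ℝ w u with hc
    set v := u - c • w with hv
    have hww : inner ℝ w w = (1 : ℝ) := by rw [real_inner_self_eq_norm_sq, hw, one_pow]
    have hvw : inner ℝ v w = 0 := by
      rw [hv, inner_sub_left, real_inner_smul_left, hww, real_inner_comm w u, ← hc]; ring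
    have hu : u = c • w + v := by simp [hv]
    have hnorm : ‖u‖ ^ 2 = c ^ 2 + ‖v‖ ^ 2 := by
      have hwv : inner ℝ w v = 0 := by rw [real_inner_comm]; exact hvw
      rw [← real_inner_self_eq_norm_sq u, ← real_inner_self_eq_norm_sq v, hu]
      simp only [inner_add_left, inner_add_right, real_inner_smul_left, real_inner_smul_right,
        hww, hvw, hwv]
      ring
    have hexp : ∀ n : Metric.sphere (0 : E d) 1, inner ℝ u (n : E d) ^ 2 =
        c ^ 2 * inner ℝ w (n : E d) ^ 2 + 2 * c * (inner ℝ w (n : E d) * inner ℝ v (n : E d)) +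
          inner ℝ v (n : E d) ^ 2 := fun n => by
      rw [hu, inner_add_left, real_inner_smul_left]; ring
    simp only [hexp]
    rw [integral_add, integral_add, integral_const_mul, integral_const_mul,
      integral_inner_mul_inner_eq_zero hg hw hvw, integral_inner_sq_self hd hg hw, hb v hvw, hnorm]
    · ring
    all_goals exact integrable_of_continuous_sphere _ (by fun_prop)
  -- The trace of the second moment form is `1`, which determines `b`.
  have htr : ∑ i : Fin d, ∫ n, inner ℝ (EuclideanSpace.single i (1 : ℝ)) (n : E d) ^ 2
      ∂(kernelMeasure g w) = 1 := by
    rw [← integral_finsetSum _ fun i _ => integrable_of_continuous_sphere _ (by fun_prop)]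
    have : ∀ n : Metric.sphere (0 : E d) 1,
        ∑ i : Fin d, inner ℝ (EuclideanSpace.single i (1 : ℝ)) (n : E d) ^ 2 = 1 := fun n => by
      have h := EuclideanSpace.norm_sq_eq (n : E d)
      rw [norm_coe_sphere] at h
      simpa [EuclideanSpace.inner_single_left] using h.symm
    simp [this]
  have hd' : (d : ℝ) - 1 ≠ 0 := by
    have : (2 : ℝ) ≤ d := by exact_mod_cast hd
    linarith
  have hw2 : ∑ i : Fin d, w i ^ 2 = 1 := by
    have h := EuclideanSpace.norm_sq_eq w
    rw [hw] at h
    simpa using h.symm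
  simp only [key, Finset.sum_add_distrib, ← Finset.mul_sum] at htr
  simp [EuclideanSpace.inner_single_right, hw2] at htr
  have hbq : b = kernelQ d g / (d - 1) := by
    rw [eq_div_iff hd']; linarith
  rw [key u, hbq]

/-- The second moment matrix of the probability measure `g(w · n) dn`. -/
theorem integral_coord_mul_coord (hd : 2 ≤ d) (hg : IsCollisionKernel d g) {w : E d}
    (hw : ‖w‖ = 1) (j l : Fin d) :
    ∫ n : Metric.sphere (0 : E d) 1, (n : E d) j * (n : E d) l ∂(kernelMeasure g w) =
      (1 - kernelQ d g - kernelQ d g / (d - 1)) * (w j * w l) +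
        kernelQ d g / (d - 1) * (1 : Matrix (Fin d) (Fin d) ℝ) j l := by
  have := hg.isProbabilityMeasure hw
  have hp : ∀ n : Metric.sphere (0 : E d) 1, (n : E d) j * (n : E d) l =
      (1 / 4 : ℝ) * (inner ℝ (EuclideanSpace.single j (1 : ℝ) + EuclideanSpace.single l 1)
        (n : E d) ^ 2 - inner ℝ (EuclideanSpace.single j (1 : ℝ) - EuclideanSpace.single l 1)
        (n : E d) ^ 2) := fun n => by
    simp [inner_add_left, inner_sub_left, EuclideanSpace.inner_single_left]; ring
  simp only [hp]
  rw [integral_const_mul, integral_sub, integral_inner_sq hd hg hw, integral_inner_sq hd hg hw,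
    norm_add_sq_real, norm_sub_sq_real]
  · simp [inner_add_right, inner_sub_right, EuclideanSpace.inner_single_right,
      Matrix.one_apply, eq_comm (a := l) (b := j)]
    split_ifs <;> ring_nf
  all_goals exact integrable_of_continuous_sphere _ (by fun_prop)

end Moments

/-! ### Characteristic functions -/

section CharFunctions

variable {d : ℕ} {g : ℝ → ℝ}

theorem mem_charFunctions_iff {φ : E d → ℂ} :
    φ ∈ charFunctions d ↔
      ∃ f : Measure (E d), IsProbabilityMeasure f ∧ ∀ k, φ k = charFun f (-k) := by
  have h : ∀ (f : Measure (E d)) (k : E d),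
      ∫ v, Complex.exp (-Complex.I * ((inner ℝ k v : ℝ) : ℂ)) ∂f = charFun f (-k) := fun f k => by
    rw [charFun_apply]
    refine integral_congr_ae (Filter.Eventually.of_forall fun v => ?_)
    simp only [inner_neg_right, real_inner_comm, Complex.ofReal_neg]
    congr 1
    ring
  simp only [charFunctions, Set.mem_ofPred_eq, h]

theorem continuous_of_mem_charFunctions {φ : E d → ℂ} (hφ : φ ∈ charFunctions d) :
    Continuous φ := by
  obtain ⟨f, hf, h⟩ := mem_charFunctions_iff.1 hφ
  rw [funext h]
  exact (continuous_charFun (μ := f)).comp continuous_neg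

theorem norm_le_one_of_mem_charFunctions {φ : E d → ℂ} (hφ : φ ∈ charFunctions d) (k : E d) :
    ‖φ k‖ ≤ 1 := by
  obtain ⟨f, _, h⟩ := mem_charFunctions_iff.1 hφ
  rw [h]
  exact norm_charFun_le_one (μ := f) (t := -k)

/-- A pointwise limit of characteristic functions that is continuous at the origin is a
characteristic function: the measures are tight, so a subsequence converges weakly. -/
theorem mem_charFunctions_of_tendsto {φ : ℕ → E d → ℂ} {ψ : E d → ℂ}
    (hφ : ∀ n, φ n ∈ charFunctions d)
    (hlim : ∀ k, Filter.Tendsto (fun n => φ n k) Filter.atTop (nhds (ψ k)))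
    (hψ : ContinuousAt ψ 0) : ψ ∈ charFunctions d := by
  choose f hf hφf using fun n => mem_charFunctions_iff.1 (hφ n)
  have hlim' : ∀ t, Filter.Tendsto (fun n => charFun (f n) t) Filter.atTop (nhds (ψ (-t))) :=
    fun t => by simpa [hφf] using hlim (-t)
  have htight : IsTightMeasureSet (Set.range f) := by
    refine isTightMeasureSet_of_tendsto_charFun (f := fun t => ψ (-t)) ?_ hlim'
    exact ContinuousAt.comp (by simpa using hψ) continuous_neg.continuousAt
  let F : ℕ → ProbabilityMeasure (E d) := fun n => ⟨f n, hf n⟩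
  have hcomp : IsCompact (closure (Set.range F)) := by
    refine isCompact_closure_of_isTightMeasureSet ?_
    convert htight using 1
    ext m
    constructor
    · rintro ⟨_, ⟨n, rfl⟩, rfl⟩
      exact ⟨n, rfl⟩
    · rintro ⟨n, rfl⟩
      exact ⟨F n, ⟨n, rfl⟩, rfl⟩
  obtain ⟨m, -, s, hs, hm⟩ := hcomp.tendsto_subseq fun n => subset_closure (Set.mem_range_self n)
  refine mem_charFunctions_iff.2 ⟨m, inferInstance, fun k => ?_⟩
  refine tendsto_nhds_unique ((hlim k).comp hs.tendsto_atTop) ?_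
  have := (ProbabilityMeasure.tendsto_iff_tendsto_charFun.1 hm) (-k)
  exact this.congr fun n => (hφf (s n) k).symm

end CharFunctions

/-! ### The gain operator -/

section Gain

variable {d : ℕ} {g : ℝ → ℝ}

/-- The direction `k / |k|` of a vector, with the convention that the direction of `0` is the
first coordinate vector. -/
noncomputable def direction (k : E d) : E d :=
  open Classical in if k = 0 then e₁ d else ‖k‖⁻¹ • k

theorem norm_direction (hd : 2 ≤ d) (k : E d) : ‖direction k‖ = 1 := by
  unfold direction
  split_ifs with h
  · exact norm_e₁ hd
  · rw [norm_smul, norm_inv, norm_norm, inv_mul_cancel₀ (norm_ne_zero_iff.2 h)]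

theorem norm_smul_direction (k : E d) : ‖k‖ • direction k = k := by
  unfold direction
  split_ifs with h
  · simp [h]
  · rw [smul_smul, mul_inv_cancel₀ (norm_ne_zero_iff.2 h), one_smul]

theorem measurable_direction : Measurable (direction : E d → E d) := by
  unfold direction
  exact Measurable.ite (measurableSet_singleton 0) measurable_const (by fun_prop)

theorem gain_eq (hd : 2 ≤ d) (hg : IsCollisionKernel d g) (φ : E d → ℂ) (k : E d) :
    gain g φ k = ∫ n : Metric.sphere (0 : E d) 1,
      φ ((1 / 2 : ℝ) • (k + ‖k‖ • (n : E d))) * φ ((1 / 2 : ℝ) • (k - ‖k‖ • (n : E d)))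
        ∂(kernelMeasure g (direction k)) := by
  have := hg.isProbabilityMeasure (norm_direction hd k)
  unfold gain
  split_ifs with h
  · subst h
    simp
  · rw [hg.integral_kernelMeasure (norm_direction hd k)]
    simp [direction, h]

/-- Exchange of the roles of the two vectors in the angular average; this is the identity that
makes the Fourier transform of the collision operator explicit. -/
theorem integral_kernelMeasure_direction_swap (hd : 2 ≤ d) (hg : IsCollisionKernel d g)
    (k u : E d) {F : Type*} [NormedAddCommGroup F] [NormedSpace ℝ F] (f : ℝ → F) :
    ∫ n : Metric.sphere (0 : E d) 1, f (‖k‖ * inner ℝ u (n : E d))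
        ∂(kernelMeasure g (direction k)) =
      ∫ n : Metric.sphere (0 : E d) 1, f (‖u‖ * inner ℝ k (n : E d))
        ∂(kernelMeasure g (direction u)) := by
  have h := integral_kernelMeasure_inner_eq hg (norm_direction hd k) (norm_direction hd u)
    fun _ y => f (‖k‖ * (‖u‖ * y))
  have h1 : ∀ (v n : E d), ‖v‖ * inner ℝ (direction v) n = inner ℝ v n := fun v n => by
    rw [← real_inner_smul_left, norm_smul_direction]
  simp only [mul_left_comm ‖k‖ ‖u‖] at h
  simp only [h1] at h
  rw [← h]
  simp only [← h1 u]
  simp only [mul_left_comm]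

/-- The post-collisional velocity `(v + w + |v - w| n) / 2`. -/
noncomputable def postVelocity (z : (E d × E d) × Metric.sphere (0 : E d) 1) : E d :=
  (1 / 2 : ℝ) • (z.1.1 + z.1.2 + ‖z.1.1 - z.1.2‖ • (z.2 : E d))

/-- The joint density of two velocities and a scattering direction. -/
noncomputable def scatteringDensity (g : ℝ → ℝ) (z : (E d × E d) × Metric.sphere (0 : E d) 1) :
    NNReal :=
  (g (inner ℝ (direction (z.1.1 - z.1.2)) (z.2 : E d))).toNNReal

theorem measurable_scatteringDensity (hd : 2 ≤ d) (hg : IsCollisionKernel d g) :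
    Measurable (scatteringDensity (d := d) g) := by
  have h : Measurable fun z : (E d × E d) × Metric.sphere (0 : E d) 1 =>
      (⟨inner ℝ (direction (z.1.1 - z.1.2)) (z.2 : E d),
        inner_sphere_mem_Icc (norm_direction hd _) z.2⟩ : Set.Icc (-1 : ℝ) 1) := by
    refine Measurable.subtype_mk (Measurable.inner ?_ (by fun_prop))
    exact measurable_direction.comp (by fun_prop)
  exact (hg.measurable.comp h).real_toNNReal

/-- The measure describing a pair of independent `f`-distributed velocities together with a
random scattering direction. -/
noncomputable def scatteringMeasure (g : ℝ → ℝ) (f : Measure (E d)) :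
    Measure ((E d × E d) × Metric.sphere (0 : E d) 1) :=
  ((f.prod f).prod (sphereMeasure d)).withDensity fun z => (scatteringDensity g z : ENNReal)

theorem isProbabilityMeasure_scatteringMeasure (hd : 2 ≤ d) (hg : IsCollisionKernel d g)
    (f : Measure (E d)) [IsProbabilityMeasure f] :
    IsProbabilityMeasure (scatteringMeasure g f) := by
  constructor
  rw [scatteringMeasure, withDensity_apply _ MeasurableSet.univ, Measure.restrict_univ,
    lintegral_prod _ (measurable_scatteringDensity hd hg).coe_nnreal_ennreal.aemeasurable]
  have h : ∀ z : E d × E d, ∫⁻ n, (scatteringDensity g (z, n) : ENNReal) ∂(sphereMeasure d) = 1 :=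
    fun z => by
      have := (hg.isProbabilityMeasure (norm_direction hd (z.1 - z.2))).measure_univ
      rwa [kernelMeasure, withDensity_apply _ MeasurableSet.univ, Measure.restrict_univ] at this
  simp [h]

theorem integral_scatteringMeasure (hd : 2 ≤ d) (hg : IsCollisionKernel d g)
    (f : Measure (E d)) [IsProbabilityMeasure f]
    {F : (E d × E d) × Metric.sphere (0 : E d) 1 → ℂ} (hF : Integrable F (scatteringMeasure g f)) :
    ∫ z, F z ∂(scatteringMeasure g f) =
      ∫ z : E d × E d, ∫ n, F (z, n) ∂(kernelMeasure g (direction (z.1 - z.2)))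
        ∂(f.prod f) := by
  have hm := measurable_scatteringDensity hd hg
  rw [scatteringMeasure, integral_withDensity_eq_integral_smul hm, integral_prod]
  · refine integral_congr_ae (Filter.Eventually.of_forall fun z => ?_)
    simp only
    rw [kernelMeasure, integral_withDensity_eq_integral_smul
      (hg.measurable_comp_inner (norm_direction hd _)).real_toNNReal]
    rfl
  · exact (integrable_withDensity_iff_integrable_smul hm).1 hF

/-- The wave `x ↦ exp (-i x)`. -/
noncomputable def wave (x : ℝ) : ℂ := Complex.exp (-Complex.I * (x : ℂ))

theorem wave_add (x y : ℝ) : wave (x + y) = wave x * wave y := by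
  rw [wave, wave, wave, ← Complex.exp_add]
  congr 1
  push_cast
  ring

theorem continuous_wave : Continuous wave := by
  unfold wave
  fun_prop

theorem norm_wave (x : ℝ) : ‖wave x‖ = 1 := by
  have : -Complex.I * (x : ℂ) = ((-x : ℝ) : ℂ) * Complex.I := by push_cast; ring
  rw [wave, this, Complex.norm_exp_ofReal_mul_I]

theorem integrable_wave {X : Type*} [MeasurableSpace X] {μ : Measure X} [IsFiniteMeasure μ]
    {f : X → ℝ} (hf : Measurable f) : Integrable (fun x => wave (f x)) μ :=
  Integrable.of_bound (continuous_wave.measurable.comp hf).aestronglyMeasurable 1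
    (Filter.Eventually.of_forall fun _ => (norm_wave _).le)

/-- The gain operator maps characteristic functions to characteristic functions: if `φ` is the
characteristic function of `f`, then `Γ[φ]` is that of the law of the post-collisional velocity of
two independent `f`-distributed velocities. -/
theorem gain_mem_charFunctions (hd : 2 ≤ d) (hg : IsCollisionKernel d g) {φ : E d → ℂ}
    (hφ : φ ∈ charFunctions d) : gain g φ ∈ charFunctions d := by
  obtain ⟨f, hf, h⟩ := hφ
  replace h : ∀ k, φ k = ∫ v, wave (inner ℝ k v) ∂f := h
  have := isProbabilityMeasure_scatteringMeasure hd hg f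
  have hpm : Measurable (postVelocity : (E d × E d) × Metric.sphere (0 : E d) 1 → E d) := by
    unfold postVelocity
    fun_prop
  refine ⟨(scatteringMeasure g f).map postVelocity,
    Measure.isProbabilityMeasure_map hpm.aemeasurable, fun k => ?_⟩
  change _ = ∫ v, wave (inner ℝ k v) ∂_
  have := hg.isProbabilityMeasure (norm_direction hd k)
  have hw : Continuous fun v : E d => wave (inner ℝ k v) := continuous_wave.comp (by fun_prop)
  rw [integral_map hpm.aemeasurable hw.aestronglyMeasurable,
    integral_scatteringMeasure hd hg f (integrable_wave (hpm.const_inner)), gain_eq hd hg]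
  have h1 : ∀ n : Metric.sphere (0 : E d) 1,
      φ ((1 / 2 : ℝ) • (k + ‖k‖ • (n : E d))) * φ ((1 / 2 : ℝ) • (k - ‖k‖ • (n : E d))) =
        ∫ z : E d × E d, wave ((1 / 2 : ℝ) * inner ℝ k (z.1 + z.2) +
          (1 / 2 : ℝ) * (‖k‖ * inner ℝ (z.1 - z.2) (n : E d))) ∂(f.prod f) := fun n => by
    rw [h, h, ← integral_prod_mul]
    refine integral_congr_ae (Filter.Eventually.of_forall fun z => ?_)
    simp only
    rw [← wave_add]
    congr 1
    rw [real_inner_comm (n : E d) (z.1 - z.2)]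
    simp only [real_inner_smul_left, inner_add_left, inner_sub_left, inner_add_right,
      inner_sub_right]
    ring
  simp only [h1]
  rw [integral_integral_swap]
  · refine integral_congr_ae (Filter.Eventually.of_forall fun z => ?_)
    simp only
    rw [integral_kernelMeasure_direction_swap hd hg k (z.1 - z.2)
      fun y => wave ((1 / 2 : ℝ) * inner ℝ k (z.1 + z.2) + (1 / 2 : ℝ) * y)]
    refine integral_congr_ae (Filter.Eventually.of_forall fun n => ?_)
    simp only [postVelocity, real_inner_smul_right, inner_add_right]
    congr 1
    ring
  · exact integrable_wave (by fun_prop)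

end Gain

/-! ### The resolvent integral of the linear deformation -/

section Evolution

variable {d : ℕ}

theorem norm_exp_clm_le (M : E d →L[ℝ] E d) : ‖NormedSpace.exp M‖ ≤ Real.exp ‖M‖ := by
  rw [NormedSpace.exp_eq_tsum ℝ, Real.exp_eq_exp_ℝ, NormedSpace.exp_eq_tsum ℝ]
  have hle : ∀ n : ℕ, ‖((n.factorial : ℝ)⁻¹) • M ^ n‖ ≤ ((n.factorial : ℝ)⁻¹) • ‖M‖ ^ n := by
    intro n
    rw [norm_smul, norm_inv, Real.norm_natCast, smul_eq_mul]
    gcongr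
    rcases Nat.eq_zero_or_pos n with rfl | hn
    · have h1 : ‖(1 : E d →L[ℝ] E d)‖ ≤ 1 := ContinuousLinearMap.norm_id_le
      simpa using h1
    · exact norm_pow_le' M hn
  have hs : Summable fun n : ℕ => ((n.factorial : ℝ)⁻¹) • ‖M‖ ^ n :=
    NormedSpace.expSeries_summable' (𝕂 := ℝ) ‖M‖
  exact tsum_of_norm_bounded hs.hasSum hle

/-- The backward linear flow `e^{-τ M} k`. -/
noncomputable def flow (M : E d →L[ℝ] E d) (τ : ℝ) : E d →L[ℝ] E d :=
  NormedSpace.exp (-(τ • M))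

theorem flow_eq (M : E d →L[ℝ] E d) (τ : ℝ) : flow M τ = NormedSpace.exp (τ • (-M)) := by
  rw [flow, smul_neg]

theorem continuous_flow (M : E d →L[ℝ] E d) : Continuous (flow M) := by
  rw [funext (flow_eq M)]
  exact continuous_iff_continuousAt.2 fun τ =>
    (hasDerivAt_exp_smul_const (𝕂 := ℝ) (-M) τ).continuousAt

theorem flow_zero (M : E d →L[ℝ] E d) : flow M 0 = 1 := by
  have h : (0 : ℝ) • M = 0 := zero_smul ℝ M
  rw [flow, h, neg_zero, NormedSpace.exp_zero]

theorem hasDerivAt_flow_apply (M : E d →L[ℝ] E d) (k : E d) (τ : ℝ) :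
    HasDerivAt (fun t => flow M t k) (-(M (flow M τ k))) τ := by
  have h := hasDerivAt_exp_smul_const' (𝕂 := ℝ) (-M) τ
  have h2 := ((ContinuousLinearMap.apply ℝ (E d) k).hasFDerivAt).comp_hasDerivAt τ h
  simp only [flow_eq]
  exact h2

theorem norm_flow_apply_le {M : E d →L[ℝ] E d} {η : ℝ} (hM : ‖M‖ ≤ η) {τ : ℝ} (hτ : 0 ≤ τ)
    (k : E d) : ‖flow M τ k‖ ≤ Real.exp (η * τ) * ‖k‖ := by
  refine (ContinuousLinearMap.le_opNorm _ _).trans ?_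
  gcongr
  refine (norm_exp_clm_le _).trans (Real.exp_le_exp.2 ?_)
  rw [norm_neg, norm_smul, Real.norm_of_nonneg hτ, mul_comm]
  gcongr

/-- The operator `φ ↦ ∫_0^∞ e^{-τ} φ(e^{-τ M} ·) dτ`. -/
noncomputable def evolve (M : E d →L[ℝ] E d) (φ : E d → ℂ) (k : E d) : ℂ :=
  ∫ τ in Set.Ioi (0 : ℝ), (Real.exp (-τ) : ℂ) * φ (flow M τ k)

/-- The exponential law with parameter `1`. -/
noncomputable def exponentialLaw : Measure ℝ :=
  (volume.restrict (Set.Ioi (0 : ℝ))).withDensity fun τ => ((Real.exp (-τ)).toNNReal : ENNReal)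

instance isProbabilityMeasure_exponentialLaw : IsProbabilityMeasure exponentialLaw := by
  constructor
  rw [exponentialLaw, withDensity_apply _ MeasurableSet.univ, Measure.restrict_univ]
  have h := ofReal_integral_eq_lintegral_ofReal (integrableOn_exp_neg_Ioi 0)
    (Filter.Eventually.of_forall fun τ => (Real.exp_pos (-τ)).le)
  rw [integral_exp_neg_Ioi_zero, ENNReal.ofReal_one] at h
  exact h.symm

theorem integral_exponentialLaw (f : ℝ → ℂ) :
    ∫ τ, f τ ∂exponentialLaw = ∫ τ in Set.Ioi (0 : ℝ), (Real.exp (-τ) : ℂ) * f τ := by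
  rw [exponentialLaw, integral_withDensity_eq_integral_smul (by fun_prop)]
  refine integral_congr_ae (Filter.Eventually.of_forall fun τ => ?_)
  simp only [NNReal.smul_def, Real.coe_toNNReal _ (Real.exp_pos (-τ)).le, Complex.real_smul]

theorem integrable_exponentialLaw_iff {f : ℝ → ℂ} :
    Integrable f exponentialLaw ↔
      IntegrableOn (fun τ => (Real.exp (-τ) : ℂ) * f τ) (Set.Ioi 0) := by
  rw [exponentialLaw, integrable_withDensity_iff_integrable_smul (by fun_prop)]
  refine integrable_congr (Filter.Eventually.of_forall fun τ => ?_)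
  simp only [NNReal.smul_def, Real.coe_toNNReal _ (Real.exp_pos (-τ)).le, Complex.real_smul]

theorem integrable_comp_flow (M : E d →L[ℝ] E d) {φ : E d → ℂ} (hφ : Continuous φ) {C : ℝ}
    (hC : ∀ k, ‖φ k‖ ≤ C) (k : E d) :
    Integrable (fun τ => φ (flow M τ k)) exponentialLaw := by
  refine Integrable.of_bound (Continuous.aestronglyMeasurable ?_) C
    (Filter.Eventually.of_forall fun τ => hC _)
  exact hφ.comp ((continuous_flow M).clm_apply continuous_const)

/-- The resolvent integral maps characteristic functions to characteristic functions: it mixes the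
pushforwards of the measure under the adjoints of the flow. -/
theorem evolve_mem_charFunctions (M : E d →L[ℝ] E d) {φ : E d → ℂ} (hφ : φ ∈ charFunctions d) :
    evolve M φ ∈ charFunctions d := by
  obtain ⟨f, hf, h⟩ := hφ
  replace h : ∀ k, φ k = ∫ v, wave (inner ℝ k v) ∂f := h
  let S : ℝ × E d → E d := fun z => ContinuousLinearMap.adjoint (flow M z.1) z.2
  have hS : Continuous S := by
    have h1 : Continuous fun z : ℝ × E d => ContinuousLinearMap.adjoint (flow M z.1) :=
      ContinuousLinearMap.adjoint.continuous.comp ((continuous_flow M).comp continuous_fst)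
    exact h1.clm_apply continuous_snd
  refine ⟨(exponentialLaw.prod f).map S,
    Measure.isProbabilityMeasure_map hS.aemeasurable, fun k => ?_⟩
  change _ = ∫ v, wave (inner ℝ k v) ∂_
  have hw : Continuous fun v : E d => wave (inner ℝ k v) := continuous_wave.comp (by fun_prop)
  rw [integral_map hS.aemeasurable hw.aestronglyMeasurable,
    integral_prod _ (integrable_wave (by fun_prop)), evolve, ← integral_exponentialLaw]
  refine integral_congr_ae (Filter.Eventually.of_forall fun τ => ?_)
  simp only [S, h, ContinuousLinearMap.adjoint_inner_right]

/-- The resolvent integral is bounded for the distance with weight `|k|^p`. -/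
theorem norm_evolve_sub_le {M : E d →L[ℝ] E d} {η p C : ℝ} (hM : ‖M‖ ≤ η) (hp : 0 ≤ p)
    (hη : p * η < 1) {φ ψ : E d → ℂ} (k : E d)
    (hφ : Integrable (fun τ => φ (flow M τ k)) exponentialLaw)
    (hψ : Integrable (fun τ => ψ (flow M τ k)) exponentialLaw)
    (h : ∀ k, ‖φ k - ψ k‖ ≤ C * ‖k‖ ^ p) :
    ‖evolve M φ k - evolve M ψ k‖ ≤ C / (1 - p * η) * ‖k‖ ^ p := by
  have hneg : -(1 - p * η) < 0 := by linarith
  rw [evolve, evolve, ← integral_sub (integrable_exponentialLaw_iff.1 hφ)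
    (integrable_exponentialLaw_iff.1 hψ)]
  have hint : IntegrableOn (fun τ : ℝ => C * ‖k‖ ^ p * Real.exp (-(1 - p * η) * τ))
      (Set.Ioi 0) := (integrableOn_exp_mul_Ioi hneg 0).const_mul _
  refine (norm_integral_le_of_norm_le hint ?_).trans (le_of_eq ?_)
  · refine (ae_restrict_iff' measurableSet_Ioi).2 (Filter.Eventually.of_forall fun τ hτ => ?_)
    have hτ0 : (0 : ℝ) ≤ τ := le_of_lt hτ
    rw [← mul_sub, norm_mul, Complex.norm_real, Real.norm_of_nonneg (Real.exp_pos _).le]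
    rcases eq_or_ne k 0 with rfl | hk
    · have h0 := h 0
      have : flow M τ 0 = 0 := map_zero _
      rw [this]
      rcases hp.eq_or_lt with rfl | hp'
      · simp only [norm_zero, Real.rpow_zero, mul_one, zero_mul, sub_zero] at h0 ⊢
        rw [mul_comm C]
        have : Real.exp (-1 * τ) = Real.exp (-τ) := by ring_nf
        rw [this]
        gcongr
      · rw [norm_zero, Real.zero_rpow hp'.ne', mul_zero] at h0 ⊢
        rw [zero_mul]
        exact mul_nonpos_of_nonneg_of_nonpos (Real.exp_pos _).le h0
    · have hkp : 0 < ‖k‖ ^ p := Real.rpow_pos_of_pos (norm_pos_iff.2 hk) _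
      have hC : 0 ≤ C := nonneg_of_mul_nonneg_left ((norm_nonneg _).trans (h k)) hkp
      calc Real.exp (-τ) * ‖φ (flow M τ k) - ψ (flow M τ k)‖
          ≤ Real.exp (-τ) * (C * (Real.exp (η * τ) * ‖k‖) ^ p) := by
            gcongr
            refine (h _).trans ?_
            gcongr
            exact norm_flow_apply_le hM hτ0 k
        _ = C * ‖k‖ ^ p * (Real.exp (-τ) * Real.exp (η * τ * p)) := by
            rw [Real.mul_rpow (Real.exp_pos _).le (norm_nonneg _), ← Real.exp_mul]
            ring
        _ = C * ‖k‖ ^ p * Real.exp (-(1 - p * η) * τ) := by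
            rw [← Real.exp_add]
            ring_nf
  · rw [integral_const_mul, integral_exp_mul_Ioi hneg, mul_zero, Real.exp_zero]
    rw [neg_div_neg_eq]
    ring

end Evolution

/-! ### Quadratic forms and the resolvent integral -/

section Quadratic

variable {d : ℕ}

/-- The quadratic form `∑ b_{jl} k_j k_l` of a real matrix. -/
def quadForm (N : Matrix (Fin d) (Fin d) ℝ) (k : E d) : ℝ :=
  ∑ j, ∑ l, N j l * (k j * k l)

theorem quadForm_eq_inner (N : Matrix (Fin d) (Fin d) ℝ) (k : E d) :
    quadForm N k = inner ℝ k (toCLM N k) := by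
  simp only [quadForm, PiLp.inner_apply, RCLike.inner_apply, conj_trivial, toCLM,
    Matrix.ofLp_toEuclideanCLM, Matrix.mulVec, dotProduct]
  refine Finset.sum_congr rfl fun j _ => ?_
  rw [Finset.sum_mul]
  exact Finset.sum_congr rfl fun l _ => by ring

theorem abs_quadForm_le (N : Matrix (Fin d) (Fin d) ℝ) (k : E d) :
    |quadForm N k| ≤ ‖toCLM N‖ * ‖k‖ ^ 2 := by
  rw [quadForm_eq_inner]
  refine (abs_real_inner_le_norm _ _).trans ?_
  have := (toCLM N).le_opNorm k
  nlinarith [norm_nonneg k]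

theorem quadForm_add (N N' : Matrix (Fin d) (Fin d) ℝ) (k : E d) :
    quadForm (N + N') k = quadForm N k + quadForm N' k := by
  simp [quadForm, add_mul, Finset.sum_add_distrib]

theorem quadForm_transpose (N : Matrix (Fin d) (Fin d) ℝ) (k : E d) :
    quadForm N.transpose k = quadForm N k := by
  rw [quadForm, Finset.sum_comm]
  refine Finset.sum_congr rfl fun l _ => Finset.sum_congr rfl fun j _ => ?_
  rw [Matrix.transpose_apply, mul_comm (k.ofLp j)]

theorem continuous_quadForm (N : Matrix (Fin d) (Fin d) ℝ) : Continuous (quadForm N) := by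
  unfold quadForm
  fun_prop

theorem inner_toCLM_of_isSymm {N : Matrix (Fin d) (Fin d) ℝ} (hN : N.IsSymm) (x y : E d) :
    inner ℝ x (toCLM N y) = inner ℝ y (toCLM N x) := by
  simp only [PiLp.inner_apply, RCLike.inner_apply, conj_trivial, toCLM,
    Matrix.ofLp_toEuclideanCLM, Matrix.mulVec, dotProduct, Finset.sum_mul]
  rw [Finset.sum_comm]
  refine Finset.sum_congr rfl fun j _ => Finset.sum_congr rfl fun l _ => ?_
  rw [hN.apply]
  ring

/-- Along the flow of `-B` the form of a symmetric matrix `N` has derivative `-(N B + (N B)ᵀ)`. -/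
theorem hasDerivAt_quadForm_flow {N : Matrix (Fin d) (Fin d) ℝ} (hN : N.IsSymm)
    (B : Matrix (Fin d) (Fin d) ℝ) (k : E d) (τ : ℝ) :
    HasDerivAt (fun t => quadForm N (flow (toCLM B) t k))
      (-(quadForm (N * B + (N * B).transpose) (flow (toCLM B) τ k))) τ := by
  have h1 := hasDerivAt_flow_apply (toCLM B) k τ
  have h2 := ((toCLM N).hasFDerivAt).comp_hasDerivAt τ h1
  have h3 := h1.inner ℝ h2
  simp only [Function.comp_def, ← quadForm_eq_inner] at h3
  refine h3.congr_deriv ?_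
  rw [quadForm_add, quadForm_transpose, quadForm_eq_inner, map_neg, inner_neg_right,
    inner_neg_left, inner_toCLM_of_isSymm hN (toCLM B _)]
  have hmul : ∀ x, toCLM (N * B) x = toCLM N (toCLM B x) := fun x => by
    simp [toCLM, map_mul]
  rw [hmul]
  ring

/-- If `K = N + N B + (N B)ᵀ`, then `1 - ½ N` is the resolvent integral of `1 - ½ K`. -/
theorem evolve_one_sub_quadForm {N B : Matrix (Fin d) (Fin d) ℝ} (hN : N.IsSymm) {η : ℝ}
    (hB : ‖toCLM B‖ ≤ η) (hη : 2 * η < 1) (k : E d) :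
    Integrable (fun τ => ((1 - 1 / 2 * quadForm (N + (N * B + (N * B).transpose))
      (flow (toCLM B) τ k) : ℝ) : ℂ)) exponentialLaw ∧
    evolve (toCLM B)
      (fun k => ((1 - 1 / 2 * quadForm (N + (N * B + (N * B).transpose)) k : ℝ) : ℂ)) k =
      ((1 - 1 / 2 * quadForm N k : ℝ) : ℂ) := by
  set K := N + (N * B + (N * B).transpose) with hK
  have hη0 : 0 ≤ η := (norm_nonneg _).trans hB
  have hneg : -(1 - 2 * η) < 0 := by linarith
  have hdecay : ∀ (P : Matrix (Fin d) (Fin d) ℝ) (τ : ℝ), 0 ≤ τ →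
      ‖Real.exp (-τ) * (1 - 1 / 2 * quadForm P (flow (toCLM B) τ k))‖ ≤
        (1 + ‖toCLM P‖ * ‖k‖ ^ 2) * Real.exp (-(1 - 2 * η) * τ) := by
    intro P τ hτ
    rw [norm_mul, Real.norm_of_nonneg (Real.exp_pos _).le]
    have h1 : ‖1 - 1 / 2 * quadForm P (flow (toCLM B) τ k)‖ ≤
        (1 + ‖toCLM P‖ * ‖k‖ ^ 2) * Real.exp (2 * η * τ) := by
      have h2 := abs_quadForm_le P (flow (toCLM B) τ k)
      have h3 := norm_flow_apply_le hB hτ k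
      have h4 : ‖flow (toCLM B) τ k‖ ^ 2 ≤ Real.exp (2 * η * τ) * ‖k‖ ^ 2 := by
        calc ‖flow (toCLM B) τ k‖ ^ 2 ≤ (Real.exp (η * τ) * ‖k‖) ^ 2 := by gcongr
          _ = Real.exp (2 * η * τ) * ‖k‖ ^ 2 := by
            rw [mul_pow, ← Real.exp_nat_mul, Nat.cast_ofNat, mul_assoc]
      have h5 : 1 ≤ Real.exp (2 * η * τ) := Real.one_le_exp (by positivity)
      have h6 : |quadForm P (flow (toCLM B) τ k)| ≤
          ‖toCLM P‖ * (Real.exp (2 * η * τ) * ‖k‖ ^ 2) := h2.trans (by gcongr)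
      rw [Real.norm_eq_abs]
      have h7 := abs_le.1 h6
      have h8 : 0 ≤ ‖toCLM P‖ * (Real.exp (2 * η * τ) * ‖k‖ ^ 2) := by positivity
      rw [abs_le]
      constructor <;> nlinarith
    calc Real.exp (-τ) * ‖1 - 1 / 2 * quadForm P (flow (toCLM B) τ k)‖
        ≤ Real.exp (-τ) * ((1 + ‖toCLM P‖ * ‖k‖ ^ 2) * Real.exp (2 * η * τ)) := by gcongr
      _ = (1 + ‖toCLM P‖ * ‖k‖ ^ 2) * (Real.exp (-τ) * Real.exp (2 * η * τ)) := by ring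
      _ = _ := by rw [← Real.exp_add]; ring_nf
  have hflow : Continuous fun τ => flow (toCLM B) τ k :=
    (continuous_flow _).clm_apply continuous_const
  have hint : IntegrableOn (fun τ => Real.exp (-τ) *
      (1 - 1 / 2 * quadForm K (flow (toCLM B) τ k))) (Set.Ioi 0) := by
    refine Integrable.mono' ((integrableOn_exp_mul_Ioi hneg 0).const_mul
      (1 + ‖toCLM K‖ * ‖k‖ ^ 2)) (Continuous.aestronglyMeasurable ?_)
      ((ae_restrict_iff' measurableSet_Ioi).2 (Filter.Eventually.of_forall fun τ hτ =>
        hdecay K τ (le_of_lt hτ)))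
    have := (continuous_quadForm K).comp hflow
    exact (by fun_prop : Continuous fun τ : ℝ => Real.exp (-τ)).mul
      (continuous_const.sub (continuous_const.mul this))
  -- The antiderivative `-e^{-τ} (1 - ½ N)` along the flow vanishes at infinity.
  have hlim : Filter.Tendsto (fun τ => -(Real.exp (-τ) *
      (1 - 1 / 2 * quadForm N (flow (toCLM B) τ k)))) Filter.atTop (nhds 0) := by
    rw [← neg_zero]
    refine Filter.Tendsto.neg (squeeze_zero_norm' ((Filter.eventually_ge_atTop 0).mono
      fun τ hτ => hdecay N τ hτ) ?_)
    have h := (Real.tendsto_exp_atBot.comp (Filter.tendsto_id.const_mul_atTop_of_neg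
      hneg)).const_mul (1 + ‖toCLM N‖ * ‖k‖ ^ 2)
    rw [mul_zero] at h
    exact h
  have hderiv : ∀ τ ∈ Set.Ici (0 : ℝ), HasDerivAt (fun τ => -(Real.exp (-τ) *
      (1 - 1 / 2 * quadForm N (flow (toCLM B) τ k))))
      (Real.exp (-τ) * (1 - 1 / 2 * quadForm K (flow (toCLM B) τ k))) τ := by
    intro τ _
    have h1 := (hasDerivAt_quadForm_flow hN B k τ).const_mul (1 / 2 : ℝ)
    have h2 := ((hasDerivAt_neg τ).exp.mul (h1.const_sub 1)).neg
    refine h2.congr_deriv ?_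
    rw [hK, quadForm_add N]
    ring
  have hval := integral_Ioi_of_hasDerivAt_of_tendsto' hderiv hint hlim
  refine ⟨integrable_exponentialLaw_iff.2 ?_, ?_⟩
  · have h := hint.ofReal (𝕜 := ℂ)
    simp only [RCLike.ofReal_mul] at h
    exact h
  · have h0 : flow (toCLM B) 0 k = k := by rw [flow_zero]; rfl
    simp only [neg_zero, Real.exp_zero, one_mul, h0, zero_sub, neg_neg] at hval
    simp only [evolve]
    rw [← hval, ← integral_complex_ofReal]
    refine integral_congr_ae (Filter.Eventually.of_forall fun τ => ?_)
    push_cast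
    rfl

end Quadratic

/-! ### Contractivity of the gain operator -/

section Contraction

variable {d : ℕ} {g : ℝ → ℝ}

/-- The factor by which the gain operator contracts the distance with weight `|k|^p`. -/
noncomputable def contractionFactor (d : ℕ) (g : ℝ → ℝ) (p : ℝ) : ℝ :=
  ∫ n, (((1 + inner ℝ (e₁ d) (n : E d)) / 2) ^ (p / 2) +
    ((1 - inner ℝ (e₁ d) (n : E d)) / 2) ^ (p / 2)) ∂(kernelMeasure g (e₁ d))

theorem contractionFactor_eq (hd : 2 ≤ d) (hg : IsCollisionKernel d g) (p : ℝ) {w : E d}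
    (hw : ‖w‖ = 1) :
    ∫ n, (((1 + inner ℝ w (n : E d)) / 2) ^ (p / 2) +
      ((1 - inner ℝ w (n : E d)) / 2) ^ (p / 2)) ∂(kernelMeasure g w) =
        contractionFactor d g p :=
  integral_kernelMeasure_inner_eq hg hw (norm_e₁ hd)
    fun x _ => ((1 + x) / 2) ^ (p / 2) + ((1 - x) / 2) ^ (p / 2)

theorem contractionFactor_nonneg (hd : 2 ≤ d) (p : ℝ) : 0 ≤ contractionFactor d g p := by
  refine integral_nonneg fun n => ?_
  have h := inner_sphere_mem_Icc (norm_e₁ hd) n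
  have h1 : 0 ≤ (1 + inner ℝ (e₁ d) (n : E d)) / 2 := by linarith [h.1]
  have h2 : 0 ≤ (1 - inner ℝ (e₁ d) (n : E d)) / 2 := by linarith [h.2]
  simp only [Pi.zero_apply]
  positivity

/-- Strict contractivity: `a^{p/2} + (1 - a)^{p/2} < 1` for `0 < a < 1` and `p > 2`. -/
theorem contractionFactor_lt_one (hd : 2 ≤ d) (hg : IsCollisionKernel d g) {p : ℝ} (hp : 2 < p) :
    contractionFactor d g p < 1 := by
  have := hg.isProbabilityMeasure (norm_e₁ hd)
  have hp2 : 1 < p / 2 := by linarith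
  have hf : Continuous fun x : ℝ => ((1 + x) / 2) ^ (p / 2) + ((1 - x) / 2) ^ (p / 2) := by
    refine Continuous.add ?_ ?_ <;>
    exact Continuous.rpow_const (by fun_prop) fun _ => Or.inr (by linarith)
  have h := integral_kernelMeasure_pos hd hg (norm_e₁ hd)
    (f := fun x => 1 - (((1 + x) / 2) ^ (p / 2) + ((1 - x) / 2) ^ (p / 2)))
    (continuous_const.sub hf) (fun x hx => ?_) (fun x hx => ?_)
  · have hfn : Continuous fun n : Metric.sphere (0 : E d) 1 =>
        ((1 + inner ℝ (e₁ d) (n : E d)) / 2) ^ (p / 2) +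
          ((1 - inner ℝ (e₁ d) (n : E d)) / 2) ^ (p / 2) :=
      hf.comp (g := fun x : ℝ => _) (by fun_prop)
    rw [integral_sub (integrable_const _) (integrable_of_continuous_sphere _ hfn)] at h
    simp only [integral_const, probReal_univ, smul_eq_mul, mul_one] at h
    rw [contractionFactor]
    linarith
  · have h1 : ((1 + x) / 2) ^ (p / 2) ≤ (1 + x) / 2 :=
      Real.rpow_le_self_of_le_one (by linarith [hx.1]) (by linarith [hx.2]) hp2.le
    have h2 : ((1 - x) / 2) ^ (p / 2) ≤ (1 - x) / 2 :=
      Real.rpow_le_self_of_le_one (by linarith [hx.2]) (by linarith [hx.1]) hp2.le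
    linarith
  · have hx' := abs_lt.1 ((sq_lt_one_iff_abs_lt_one x).1 hx)
    have h1 : ((1 + x) / 2) ^ (p / 2) < (1 + x) / 2 :=
      Real.rpow_lt_self_of_lt_one (by linarith) (by linarith) hp2
    have h2 : ((1 - x) / 2) ^ (p / 2) < (1 - x) / 2 :=
      Real.rpow_lt_self_of_lt_one (by linarith) (by linarith) hp2
    linarith

theorem norm_half_add_rpow (hd : 2 ≤ d) (k : E d) (n : Metric.sphere (0 : E d) 1) (p : ℝ) :
    ‖(1 / 2 : ℝ) • (k + ‖k‖ • (n : E d))‖ ^ p =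
      ‖k‖ ^ p * ((1 + inner ℝ (direction k) (n : E d)) / 2) ^ (p / 2) := by
  have hI := inner_sphere_mem_Icc (norm_direction hd k) n
  have hs : 0 ≤ (1 + inner ℝ (direction k) (n : E d)) / 2 := by linarith [hI.1]
  have hk : inner ℝ k (n : E d) = ‖k‖ * inner ℝ (direction k) (n : E d) := by
    rw [← real_inner_smul_left, norm_smul_direction]
  have h : ‖(1 / 2 : ℝ) • (k + ‖k‖ • (n : E d))‖ ^ 2 =
      ‖k‖ ^ 2 * ((1 + inner ℝ (direction k) (n : E d)) / 2) := by
    rw [norm_smul, mul_pow, norm_add_sq_real, real_inner_smul_right, norm_smul, norm_norm,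
      norm_coe_sphere, hk]
    norm_num
    ring
  have hpow : ∀ x : ℝ, 0 ≤ x → x ^ p = (x ^ 2) ^ (p / 2) := fun x hx => by
    rw [← Real.rpow_natCast, ← Real.rpow_mul hx]
    norm_num
    ring_nf
  rw [hpow _ (norm_nonneg _), h, Real.mul_rpow (by positivity) hs, ← hpow _ (norm_nonneg k)]

theorem norm_half_sub_rpow (hd : 2 ≤ d) (k : E d) (n : Metric.sphere (0 : E d) 1) (p : ℝ) :
    ‖(1 / 2 : ℝ) • (k - ‖k‖ • (n : E d))‖ ^ p =
      ‖k‖ ^ p * ((1 - inner ℝ (direction k) (n : E d)) / 2) ^ (p / 2) := by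
  have h := norm_half_add_rpow hd k (-n) p
  simpa [← sub_eq_add_neg] using h

theorem continuous_gain_integrand {φ : E d → ℂ} (hφ : Continuous φ) (k : E d) :
    Continuous fun n : Metric.sphere (0 : E d) 1 =>
      φ ((1 / 2 : ℝ) • (k + ‖k‖ • (n : E d))) * φ ((1 / 2 : ℝ) • (k - ‖k‖ • (n : E d))) :=
  (hφ.comp (by fun_prop)).mul (hφ.comp (by fun_prop))

/-- The gain operator contracts the distance with weight `|k|^p`, because both factors are bounded
by one. -/
theorem norm_gain_sub_le (hd : 2 ≤ d) (hg : IsCollisionKernel d g) {p C : ℝ} (hp : 0 ≤ p)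
    {φ ψ : E d → ℂ} (hφ : φ ∈ charFunctions d) (hψ : ψ ∈ charFunctions d)
    (h : ∀ k, ‖φ k - ψ k‖ ≤ C * ‖k‖ ^ p) (k : E d) :
    ‖gain g φ k - gain g ψ k‖ ≤ contractionFactor d g p * C * ‖k‖ ^ p := by
  have := hg.isProbabilityMeasure (norm_direction hd k)
  have hcφ := continuous_gain_integrand (continuous_of_mem_charFunctions hφ) k
  have hcψ := continuous_gain_integrand (continuous_of_mem_charFunctions hψ) k
  rw [gain_eq hd hg, gain_eq hd hg, ← integral_sub (integrable_of_continuous_sphere _ hcφ)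
    (integrable_of_continuous_sphere _ hcψ), ← contractionFactor_eq hd hg p (norm_direction hd k)]
  have hrhs : Continuous fun n : Metric.sphere (0 : E d) 1 =>
      C * ‖k‖ ^ p * (((1 + inner ℝ (direction k) (n : E d)) / 2) ^ (p / 2) +
        ((1 - inner ℝ (direction k) (n : E d)) / 2) ^ (p / 2)) := by
    refine continuous_const.mul (Continuous.add ?_ ?_) <;>
    exact Continuous.rpow_const (by fun_prop) fun _ => Or.inr (by linarith)
  refine (norm_integral_le_of_norm_le (integrable_of_continuous_sphere _ hrhs)
    (Filter.Eventually.of_forall fun n => ?_)).trans (le_of_eq ?_)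
  · set a := (1 / 2 : ℝ) • (k + ‖k‖ • (n : E d)) with ha
    set b := (1 / 2 : ℝ) • (k - ‖k‖ • (n : E d)) with hb
    calc ‖φ a * φ b - ψ a * ψ b‖ = ‖(φ a - ψ a) * φ b + ψ a * (φ b - ψ b)‖ := by ring_nf
      _ ≤ ‖φ a - ψ a‖ * ‖φ b‖ + ‖ψ a‖ * ‖φ b - ψ b‖ := by
          rw [← norm_mul, ← norm_mul]; exact norm_add_le _ _
      _ ≤ ‖φ a - ψ a‖ * 1 + 1 * ‖φ b - ψ b‖ := by
          gcongr
          · exact norm_le_one_of_mem_charFunctions hφ b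
          · exact norm_le_one_of_mem_charFunctions hψ a
      _ ≤ C * ‖a‖ ^ p + C * ‖b‖ ^ p := by
          rw [mul_one, one_mul]
          exact add_le_add (h a) (h b)
      _ = _ := by
          rw [ha, hb, norm_half_add_rpow hd, norm_half_sub_rpow hd]
          ring
  · rw [integral_const_mul]
    ring

end Contraction

/-! ### Gaussian characteristic functions -/

section Gaussian

variable {d : ℕ} {g : ℝ → ℝ}

/-- The function `k ↦ exp (-½ ∑ b_{jl} k_j k_l)`. -/
noncomputable def gaussian (N : Matrix (Fin d) (Fin d) ℝ) (k : E d) : ℂ :=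
  (Real.exp (-(1 / 2 * quadForm N k)) : ℂ)

open scoped Matrix in
theorem dotProduct_mulVec_eq_quadForm (N : Matrix (Fin d) (Fin d) ℝ) (k : E d) :
    k.ofLp ⬝ᵥ N.mulVec k.ofLp = quadForm N k := by
  simp only [dotProduct, Matrix.mulVec, Finset.mul_sum]
  exact Finset.sum_congr rfl fun j _ => Finset.sum_congr rfl fun l _ => by ring

open scoped Matrix in
theorem gaussian_mem_charFunctions {N : Matrix (Fin d) (Fin d) ℝ} (hN : N.PosSemidef) :
    gaussian N ∈ charFunctions d := by
  refine mem_charFunctions_iff.2 ⟨ProbabilityTheory.multivariateGaussian 0 N, inferInstance,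
    fun k => ?_⟩
  rw [ProbabilityTheory.charFun_multivariateGaussian hN, gaussian, Complex.ofReal_exp]
  congr 1
  have h : (-k).ofLp ⬝ᵥ N.mulVec (-k).ofLp = quadForm N k := by
    rw [WithLp.ofLp_neg, Matrix.mulVec_neg, neg_dotProduct_neg, dotProduct_mulVec_eq_quadForm]
  rw [h]
  simp only [inner_zero_right, Complex.ofReal_zero, zero_mul, zero_sub]
  push_cast
  ring

/-- For `1 ≤ r ≤ 2` the function `e^{-s}` agrees with `1 - s` up to `s^r`. -/
theorem abs_exp_neg_sub_le {r s : ℝ} (h1 : 1 ≤ r) (h2 : r ≤ 2) (hs : 0 ≤ s) :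
    |Real.exp (-s) - (1 - s)| ≤ s ^ r := by
  have h0 : 0 ≤ Real.exp (-s) - (1 - s) := by linarith [Real.add_one_le_exp (-s)]
  rw [abs_of_nonneg h0]
  rcases le_total s 1 with h | h
  · have h3 := Real.abs_exp_sub_one_sub_id_le (x := -s) (by rwa [abs_neg, abs_of_nonneg hs])
    have h4 : s ^ (2 : ℝ) ≤ s ^ r := by
      rcases hs.eq_or_lt with rfl | hs'
      · rw [Real.zero_rpow (by linarith), Real.zero_rpow (by linarith)]
      · exact Real.rpow_le_rpow_of_exponent_ge hs' h h2
    rw [Real.rpow_two] at h4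
    have := (abs_le.1 h3).2
    nlinarith
  · have h3 : Real.exp (-s) ≤ 1 := Real.exp_le_one_iff.2 (by linarith)
    have h4 : s ≤ s ^ r := Real.self_le_rpow_of_one_le h h1
    linarith

theorem quadForm_nonneg {N : Matrix (Fin d) (Fin d) ℝ} (hN : N.PosSemidef) (k : E d) :
    0 ≤ quadForm N k := by
  have h := hN.dotProduct_mulVec_nonneg k.ofLp
  rwa [star_trivial, dotProduct_mulVec_eq_quadForm] at h

theorem norm_gaussian_sub_le {N : Matrix (Fin d) (Fin d) ℝ} (hN : N.PosSemidef) {p : ℝ}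
    (h2 : 2 ≤ p) (h4 : p ≤ 4) (k : E d) :
    ‖gaussian N k - ((1 - 1 / 2 * quadForm N k : ℝ) : ℂ)‖ ≤
      ‖toCLM N‖ ^ (p / 2) * ‖k‖ ^ p := by
  have hq := quadForm_nonneg hN k
  rw [gaussian, ← Complex.ofReal_sub, Complex.norm_real, Real.norm_eq_abs]
  refine (abs_exp_neg_sub_le (r := p / 2) (by linarith) (by linarith) (by positivity)).trans ?_
  have h1 : 1 / 2 * quadForm N k ≤ ‖toCLM N‖ * ‖k‖ ^ 2 := by
    have := (le_abs_self _).trans (abs_quadForm_le N k)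
    linarith
  calc (1 / 2 * quadForm N k) ^ (p / 2) ≤ (‖toCLM N‖ * ‖k‖ ^ 2) ^ (p / 2) := by
        gcongr
    _ = _ := by
        rw [Real.mul_rpow (norm_nonneg _) (by positivity), ← Real.rpow_natCast,
          ← Real.rpow_mul (norm_nonneg _)]
        norm_num
        left; ring_nf

/-- The matrix of the quadratic part of `Γ[1 - ½ N + …]`. -/
noncomputable def gainMatrix (g : ℝ → ℝ) (N : Matrix (Fin d) (Fin d) ℝ) :
    Matrix (Fin d) (Fin d) ℝ :=
  N - (kernelQ d g * d / (2 * (d - 1))) • (N - (N.trace / d) • 1)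

theorem integral_quadForm (hd : 2 ≤ d) (hg : IsCollisionKernel d g)
    (N : Matrix (Fin d) (Fin d) ℝ) {w : E d} (hw : ‖w‖ = 1) :
    ∫ n : Metric.sphere (0 : E d) 1, quadForm N n ∂(kernelMeasure g w) =
      (1 - kernelQ d g - kernelQ d g / (d - 1)) * quadForm N w +
        kernelQ d g / (d - 1) * N.trace := by
  have := hg.isProbabilityMeasure hw
  unfold quadForm
  rw [integral_finsetSum _ fun j _ => integrable_of_continuous_sphere _ (by fun_prop)]
  have h1 : ∀ j, ∫ n : Metric.sphere (0 : E d) 1,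
      ∑ l, N j l * ((n : E d) j * (n : E d) l) ∂(kernelMeasure g w) =
      ∑ l, N j l * ((1 - kernelQ d g - kernelQ d g / (d - 1)) * (w j * w l) +
        kernelQ d g / (d - 1) * (1 : Matrix (Fin d) (Fin d) ℝ) j l) := fun j => by
    rw [integral_finsetSum _ fun j _ => integrable_of_continuous_sphere _ (by fun_prop)]
    refine Finset.sum_congr rfl fun l _ => ?_
    rw [integral_const_mul, integral_coord_mul_coord hd hg hw]
  simp only [h1, mul_add, Finset.sum_add_distrib, Finset.mul_sum, Matrix.trace, Matrix.diag_apply]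
  congr 1
  · exact Finset.sum_congr rfl fun j _ => Finset.sum_congr rfl fun l _ => by ring
  · refine Finset.sum_congr rfl fun j _ => ?_
    rw [Finset.sum_eq_single j]
    · simp; ring
    · intro l _ hl
      simp [Matrix.one_apply_ne hl.symm]
    · simp

theorem quadForm_smul_apply (N : Matrix (Fin d) (Fin d) ℝ) (c : ℝ) (k : E d) :
    quadForm N (c • k) = c ^ 2 * quadForm N k := by
  simp only [quadForm, PiLp.smul_apply, smul_eq_mul, Finset.mul_sum]
  exact Finset.sum_congr rfl fun j _ => Finset.sum_congr rfl fun l _ => by ring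

theorem quadForm_half_add_half_sub (N : Matrix (Fin d) (Fin d) ℝ) (k m : E d) :
    quadForm N ((1 / 2 : ℝ) • (k + m)) + quadForm N ((1 / 2 : ℝ) • (k - m)) =
      1 / 2 * (quadForm N k + quadForm N m) := by
  simp only [quadForm, PiLp.smul_apply, PiLp.add_apply, PiLp.sub_apply, smul_eq_mul,
    Finset.mul_sum, ← Finset.sum_add_distrib]
  exact Finset.sum_congr rfl fun j _ => Finset.sum_congr rfl fun l _ => by ring

theorem quadForm_gainMatrix (N : Matrix (Fin d) (Fin d) ℝ) (k : E d) :
    quadForm (gainMatrix g N) k = quadForm N k - kernelQ d g * d / (2 * (d - 1)) *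
      (quadForm N k - N.trace / d * ‖k‖ ^ 2) := by
  have h1 : ‖k‖ ^ 2 = quadForm (1 : Matrix (Fin d) (Fin d) ℝ) k := by
    rw [quadForm_eq_inner, ← real_inner_self_eq_norm_sq]
    simp
  rw [h1]
  simp only [quadForm, gainMatrix, Matrix.sub_apply, Matrix.smul_apply, smul_eq_mul,
    Finset.mul_sum, ← Finset.sum_sub_distrib]
  exact Finset.sum_congr rfl fun j _ => Finset.sum_congr rfl fun l _ => by ring

theorem integral_quadForm_collision (hd : 2 ≤ d) (hg : IsCollisionKernel d g)
    (N : Matrix (Fin d) (Fin d) ℝ) (k : E d) :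
    ∫ n : Metric.sphere (0 : E d) 1, 1 / 2 * (quadForm N k + quadForm N (‖k‖ • (n : E d)))
      ∂(kernelMeasure g (direction k)) = quadForm (gainMatrix g N) k := by
  have := hg.isProbabilityMeasure (norm_direction hd k)
  have hc := continuous_quadForm N
  have hd1 : (d : ℝ) - 1 ≠ 0 := by
    have : (2 : ℝ) ≤ d := by exact_mod_cast hd
    linarith
  have hd0 : (d : ℝ) ≠ 0 := by
    have : (2 : ℝ) ≤ d := by exact_mod_cast hd
    linarith
  simp only [quadForm_smul_apply]
  have hcn : Continuous fun n : Metric.sphere (0 : E d) 1 => ‖k‖ ^ 2 * quadForm N (n : E d) :=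
    continuous_const.mul (hc.comp continuous_subtype_val)
  rw [integral_const_mul, integral_add (integrable_const _)
    (integrable_of_continuous_sphere _ hcn),
    integral_const_mul, integral_quadForm hd hg N (norm_direction hd k), quadForm_gainMatrix]
  have h := quadForm_smul_apply N ‖k‖ (direction k)
  rw [norm_smul_direction] at h
  rw [h]
  simp only [integral_const, probReal_univ, smul_eq_mul, one_mul]
  field_simp
  ring

/-- The gain of a Gaussian agrees with the quadratic polynomial of `gainMatrix` up to order
`|k|^p`: the exponents of the two factors add up to a nonnegative quadratic form, to which
`abs_exp_neg_sub_le` applies under the angular average. -/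
theorem norm_gain_gaussian_sub_le (hd : 2 ≤ d) (hg : IsCollisionKernel d g)
    {N : Matrix (Fin d) (Fin d) ℝ} (hN : N.PosSemidef) {p : ℝ} (h2 : 2 ≤ p) (h4 : p ≤ 4)
    (k : E d) :
    ‖gain g (gaussian N) k - ((1 - 1 / 2 * quadForm (gainMatrix g N) k : ℝ) : ℂ)‖ ≤
      ‖toCLM N‖ ^ (p / 2) * ‖k‖ ^ p := by
  have := hg.isProbabilityMeasure (norm_direction hd k)
  have hc := continuous_quadForm N
  let s : Metric.sphere (0 : E d) 1 → ℝ := fun n =>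
    1 / 2 * (1 / 2 * (quadForm N k + quadForm N (‖k‖ • (n : E d))))
  have hsc : Continuous s := by
    refine continuous_const.mul (continuous_const.mul (continuous_const.add (hc.comp ?_)))
    fun_prop
  have hG : gain g (gaussian N) k =
      ((∫ n, Real.exp (-(s n)) ∂(kernelMeasure g (direction k)) : ℝ) : ℂ) := by
    rw [gain_eq hd hg, ← integral_complex_ofReal]
    refine integral_congr_ae (Filter.Eventually.of_forall fun n => ?_)
    simp only [gaussian, s]
    rw [← Complex.ofReal_mul, ← Real.exp_add, ← quadForm_half_add_half_sub]
    congr 2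
    ring
  have hK : 1 - 1 / 2 * quadForm (gainMatrix g N) k =
      ∫ n, (1 - s n) ∂(kernelMeasure g (direction k)) := by
    rw [integral_sub (integrable_const _) (integrable_of_continuous_sphere _ hsc)]
    simp only [s]
    rw [integral_const_mul, integral_quadForm_collision hd hg]
    simp
  rw [hG, hK, ← Complex.ofReal_sub, Complex.norm_real, ← integral_sub
    (integrable_of_continuous_sphere _ (by fun_prop))
    (integrable_of_continuous_sphere _ (by fun_prop))]
  refine (norm_integral_le_of_norm_le_const (C := ‖toCLM N‖ ^ (p / 2) * ‖k‖ ^ p)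
    (Filter.Eventually.of_forall fun n => ?_)).trans (by simp)
  have hq1 := quadForm_nonneg hN k
  have hq2 := quadForm_nonneg hN (‖k‖ • (n : E d))
  have hs0 : 0 ≤ s n := by simp only [s]; positivity
  rw [Real.norm_eq_abs]
  refine (abs_exp_neg_sub_le (r := p / 2) (by linarith) (by linarith) hs0).trans ?_
  have h1 : s n ≤ ‖toCLM N‖ * ‖k‖ ^ 2 := by
    have h5 := (le_abs_self _).trans (abs_quadForm_le N k)
    have h6 := (le_abs_self _).trans (abs_quadForm_le N (‖k‖ • (n : E d)))
    rw [norm_smul, norm_norm, norm_coe_sphere, mul_one] at h6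
    have h7 : 0 ≤ ‖toCLM N‖ * ‖k‖ ^ 2 := by positivity
    simp only [s]
    linarith
  calc s n ^ (p / 2) ≤ (‖toCLM N‖ * ‖k‖ ^ 2) ^ (p / 2) := by
        gcongr
    _ = _ := by
        rw [Real.mul_rpow (norm_nonneg _) (by positivity), ← Real.rpow_natCast,
          ← Real.rpow_mul (norm_nonneg _)]
        norm_num
        left; ring_nf

end Gaussian

/-! ### The fixed point argument -/

section FixedPoint

/-- Banach's fixed point theorem for the (possibly infinite) distance
`sup_x |φ(x) - ψ(x)| / w(x)` on a set `S` of functions, restricted to the functions at finite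
distance from a given `G ∈ S`. -/
theorem existsUnique_fixedPoint_of_weighted_contraction {X : Type*} {w : X → ℝ}
    {S : Set (X → ℂ)} {T : (X → ℂ) → X → ℂ} {G : X → ℂ} {r : ℝ} (hG : G ∈ S)
    (hT : ∀ φ ∈ S, T φ ∈ S) (hr0 : 0 ≤ r) (hr1 : r < 1)
    (hcontr : ∀ φ ∈ S, ∀ ψ ∈ S, ∀ C : ℝ, (∀ x, ‖φ x - ψ x‖ ≤ C * w x) →
      ∀ x, ‖T φ x - T ψ x‖ ≤ r * C * w x)
    (hTG : ∃ C : ℝ, ∀ x, ‖T G x - G x‖ ≤ C * w x)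
    (hclosed : ∀ (φ : ℕ → X → ℂ) (ψ : X → ℂ), (∀ n, φ n ∈ S) →
      (∀ x, Filter.Tendsto (fun n => φ n x) Filter.atTop (nhds (ψ x))) →
      (∃ C : ℝ, ∀ x, ‖ψ x - G x‖ ≤ C * w x) → ψ ∈ S) :
    ∃! ψ : X → ℂ, (ψ ∈ S ∧ ∃ C : ℝ, ∀ x, ‖ψ x - G x‖ ≤ C * w x) ∧ ∀ x, ψ x = T ψ x := by
  have hpow : ∀ c : ℝ, Filter.Tendsto (fun n : ℕ => r ^ n * c) Filter.atTop (nhds 0) := fun c => by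
    simpa using (tendsto_pow_atTop_nhds_zero_of_lt_one hr0 hr1).mul_const c
  obtain ⟨C, hC⟩ := hTG
  let u : ℕ → X → ℂ := fun n => T^[n] G
  have hu : ∀ n, u (n + 1) = T (u n) := fun n => Function.iterate_succ_apply' T n G
  have huS : ∀ n, u n ∈ S := fun n => by
    induction n with
    | zero => exact hG
    | succ n ih => rw [hu]; exact hT _ ih
  have hstep : ∀ n x, ‖u (n + 1) x - u n x‖ ≤ r ^ n * C * w x := fun n => by
    induction n with
    | zero => simpa [u] using hC
    | succ n ih =>
      intro x
      rw [hu (n + 1), hu n, pow_succ', mul_assoc r]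
      have := hcontr _ (huS (n + 1)) _ (huS n) _ ih x
      rwa [hu n] at this
  have hdist : ∀ x n, dist (u n x) (u (n + 1) x) ≤ C * w x * r ^ n := fun x n => by
    rw [dist_comm, dist_eq_norm]
    exact (hstep n x).trans (le_of_eq (by ring))
  have hlim : ∀ x, ∃ y, Filter.Tendsto (fun n => u n x) Filter.atTop (nhds y) := fun x =>
    cauchySeq_tendsto_of_complete (cauchySeq_of_le_geometric r (C * w x) hr1 (hdist x))
  choose ψ hψ using hlim
  have hclose : ∀ n x, ‖u n x - ψ x‖ ≤ r ^ n * (C / (1 - r)) * w x := fun n x => by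
    rw [← dist_eq_norm]
    exact (dist_le_of_le_geometric_of_tendsto r (C * w x) hr1 (hdist x) (hψ x) n).trans
      (le_of_eq (by ring))
  have hψG : ∃ C : ℝ, ∀ x, ‖ψ x - G x‖ ≤ C * w x := ⟨C / (1 - r), fun x => by
    have := hclose 0 x
    rw [norm_sub_rev] at this
    simpa [u] using this⟩
  have hψS : ψ ∈ S := hclosed u ψ huS hψ hψG
  have hψT : ∀ x, ψ x = T ψ x := by
    intro x
    have h1 : Filter.Tendsto (fun n => u (n + 1) x) Filter.atTop (nhds (ψ x)) :=
      (hψ x).comp (Filter.tendsto_add_atTop_nat 1)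
    refine tendsto_nhds_unique h1 (tendsto_iff_norm_sub_tendsto_zero.2 ?_)
    refine squeeze_zero (fun _ => norm_nonneg _) (fun n => ?_)
      (hpow (r * (C / (1 - r)) * w x))
    rw [hu]
    exact (hcontr _ (huS n) _ hψS _ (hclose n) x).trans (le_of_eq (by ring))
  refine ⟨ψ, ⟨⟨hψS, hψG⟩, hψT⟩, ?_⟩
  · rintro χ ⟨⟨hχS, C₁, hC₁⟩, hχ⟩
    obtain ⟨C₂, hC₂⟩ := hψG
    have hiter : ∀ n : ℕ, ∀ x, ‖χ x - ψ x‖ ≤ r ^ n * (C₁ + C₂) * w x := fun n => by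
      induction n with
      | zero =>
        intro x
        calc ‖χ x - ψ x‖ = ‖(χ x - G x) - (ψ x - G x)‖ := by ring_nf
          _ ≤ ‖χ x - G x‖ + ‖ψ x - G x‖ := norm_sub_le _ _
          _ ≤ C₁ * w x + C₂ * w x := add_le_add (hC₁ x) (hC₂ x)
          _ = _ := by ring
      | succ n ih =>
        intro x
        rw [hχ x, hψT x, pow_succ', mul_assoc r]
        exact hcontr _ hχS _ hψS _ ih x
    funext x
    have h0 : ‖χ x - ψ x‖ ≤ 0 := by
      refine ge_of_tendsto' (hpow ((C₁ + C₂) * w x)) fun n => ?_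
      rw [← mul_assoc]
      exact hiter n x
    exact sub_eq_zero.1 (norm_le_zero_iff.1 h0)

end FixedPoint

/-! ### Existence and uniqueness of the stationary profile -/

section Profile

variable {d : ℕ} {g : ℝ → ℝ}

theorem coe_quadForm (N : Matrix (Fin d) (Fin d) ℝ) (k : E d) :
    ∑ j, ∑ l, (N.map Complex.ofReal) j l * (k j : ℂ) * (k l : ℂ) = (quadForm N k : ℂ) := by
  simp [quadForm, mul_assoc]

theorem mem_classF_iff {N : Matrix (Fin d) (Fin d) ℝ} {p : ℝ} {Ψ : E d → ℂ} :
    Ψ ∈ classF p (N.map Complex.ofReal) ↔ Ψ ∈ charFunctions d ∧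
      ∃ C : ℝ, ∀ k, ‖Ψ k - ((1 - 1 / 2 * quadForm N k : ℝ) : ℂ)‖ ≤ C * ‖k‖ ^ p := by
  simp only [classF, Set.mem_ofPred_eq, coe_quadForm]
  push_cast
  rfl

/-- The Gaussian with covariance `N` may replace the quadratic polynomial in the definition of
`F_p(N)`. -/
theorem mem_classF_iff_gaussian {N : Matrix (Fin d) (Fin d) ℝ} (hN : N.PosSemidef) {p : ℝ}
    (h2 : 2 ≤ p) (h4 : p ≤ 4) {Ψ : E d → ℂ} :
    Ψ ∈ classF p (N.map Complex.ofReal) ↔ Ψ ∈ charFunctions d ∧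
      ∃ C : ℝ, ∀ k, ‖Ψ k - gaussian N k‖ ≤ C * ‖k‖ ^ p := by
  rw [mem_classF_iff]
  have hG := norm_gaussian_sub_le hN h2 h4
  refine and_congr_right fun _ => ⟨?_, ?_⟩
  · rintro ⟨C, hC⟩
    refine ⟨C + ‖toCLM N‖ ^ (p / 2), fun k => ?_⟩
    rw [add_mul]
    refine (norm_sub_le_norm_sub_add_norm_sub _ _ _).trans (add_le_add (hC k) ?_)
    rw [norm_sub_rev]
    exact hG k
  · rintro ⟨C, hC⟩
    refine ⟨C + ‖toCLM N‖ ^ (p / 2), fun k => ?_⟩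
    rw [add_mul]
    exact (norm_sub_le_norm_sub_add_norm_sub _ _ _).trans (add_le_add (hC k) (hG k))

theorem classF_nonempty {N : Matrix (Fin d) (Fin d) ℝ} (hN : N.PosSemidef) {p : ℝ}
    (h2 : 2 ≤ p) (h4 : p ≤ 4) : (classF p (N.map Complex.ofReal)).Nonempty :=
  ⟨gaussian N, (mem_classF_iff_gaussian hN h2 h4).2
    ⟨gaussian_mem_charFunctions hN, 0, fun k => by simp⟩⟩

/-- Existence and uniqueness of the stationary profile, when the quadratic part `N` is compatible
with the gain operator and the matrix `B` of the deformation is small. -/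
theorem existsUnique_stationaryProfile (hd : 2 ≤ d) (hg : IsCollisionKernel d g) {p : ℝ}
    (h2 : 2 < p) (h4 : p ≤ 4) {N B : Matrix (Fin d) (Fin d) ℝ} (hN : N.PosSemidef)
    (hsymm : N.IsSymm) (hNB : gainMatrix g N = N + (N * B + (N * B).transpose))
    (hB : contractionFactor d g p + p * ‖toCLM B‖ < 1) :
    ∃! Ψ : E d → ℂ, Ψ ∈ classF p (N.map Complex.ofReal) ∧
      ∀ k, Ψ k = evolve (toCLM B) (gain g Ψ) k := by
  have hp0 : 0 ≤ p := by linarith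
  have hμ0 := contractionFactor_nonneg (g := g) hd p
  have hη : p * ‖toCLM B‖ < 1 := by linarith
  have hη2 : 2 * ‖toCLM B‖ < 1 := by nlinarith [norm_nonneg (toCLM B)]
  have hpos : 0 < 1 - p * ‖toCLM B‖ := by linarith
  have hgain : ∀ φ ∈ charFunctions d, ∀ k,
      Integrable (fun τ => gain g φ (flow (toCLM B) τ k)) exponentialLaw := fun φ hφ k => by
    have h := gain_mem_charFunctions hd hg hφ
    exact integrable_comp_flow _ (continuous_of_mem_charFunctions h)
      (norm_le_one_of_mem_charFunctions h) k
  have hGm := gaussian_mem_charFunctions hN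
  simp only [mem_classF_iff_gaussian hN h2.le h4]
  refine existsUnique_fixedPoint_of_weighted_contraction (w := fun k : E d => ‖k‖ ^ p)
    (T := fun φ => evolve (toCLM B) (gain g φ))
    (r := contractionFactor d g p / (1 - p * ‖toCLM B‖)) hGm
    (fun φ hφ => evolve_mem_charFunctions _ (gain_mem_charFunctions hd hg hφ))
    (by positivity) ((div_lt_one hpos).2 (by linarith)) ?_ ?_ ?_
  · intro φ hφ ψ hψ C hC k
    refine (norm_evolve_sub_le le_rfl hp0 hη k (hgain φ hφ k) (hgain ψ hψ k)
      (norm_gain_sub_le hd hg hp0 hφ hψ hC)).trans (le_of_eq ?_)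
    ring
  · have hpoly := fun k => evolve_one_sub_quadForm (B := B) hsymm le_rfl hη2 k
    have hbd := norm_gain_gaussian_sub_le hd hg hN h2.le h4
    rw [hNB] at hbd
    refine ⟨‖toCLM N‖ ^ (p / 2) / (1 - p * ‖toCLM B‖) + ‖toCLM N‖ ^ (p / 2), fun k => ?_⟩
    have h1 := norm_evolve_sub_le (M := toCLM B) (η := ‖toCLM B‖) (φ := gain g (gaussian N))
      (ψ := fun k => ((1 - 1 / 2 * quadForm (N + (N * B + (N * B).transpose)) k : ℝ) : ℂ))
      le_rfl hp0 hη k (hgain _ hGm k) (hpoly k).1 hbd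
    rw [(hpoly k).2] at h1
    rw [add_mul]
    refine (norm_sub_le_norm_sub_add_norm_sub _ _ _).trans (add_le_add h1 ?_)
    rw [norm_sub_rev]
    exact norm_gaussian_sub_le hN h2.le h4 k
  · rintro φ ψ hφ hlim ⟨C, hC⟩
    refine mem_charFunctions_of_tendsto hφ hlim ?_
    -- The weight vanishes at the origin, so the limit inherits continuity there from the Gaussian.
    have h0 : ψ 0 = gaussian N 0 := by
      have h := hC 0
      rw [norm_zero, Real.zero_rpow (by linarith), mul_zero] at h
      exact sub_eq_zero.1 (norm_le_zero_iff.1 h)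
    have hGc := (continuous_of_mem_charFunctions hGm).continuousAt (x := 0)
    have hdiff : Filter.Tendsto (fun k => ψ k - gaussian N k) (nhds 0) (nhds 0) := by
      refine squeeze_zero_norm hC ?_
      have hc : Continuous fun k : E d => C * ‖k‖ ^ p :=
        continuous_const.mul (continuous_norm.rpow_const fun _ => Or.inr hp0)
      have := hc.tendsto 0
      rwa [norm_zero, Real.zero_rpow (by linarith), mul_zero] at this
    have h := hdiff.add hGc.tendsto
    rw [ContinuousAt, h0]
    simpa using h

end Profile

/-! ### The dominant eigenvalue of the moment problem -/

section MomentProblem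

open scoped Matrix.Norms.Frobenius

variable {d : ℕ} {g : ℝ → ℝ}

section Norms

variable {𝕜 : Type*} [RCLike 𝕜]

theorem norm_entry_le_frobenius (M : Matrix (Fin d) (Fin d) 𝕜) (i j : Fin d) :
    ‖M i j‖ ≤ ‖M‖ := by
  rw [Matrix.frobenius_norm_def, ← Real.sqrt_eq_rpow]
  refine Real.le_sqrt_of_sq_le ?_
  simp only [Real.rpow_two]
  exact (Finset.single_le_sum (f := fun j => ‖M i j‖ ^ 2) (fun _ _ => by positivity)
    (Finset.mem_univ j)).trans
    (Finset.single_le_sum (f := fun i => ∑ j, ‖M i j‖ ^ 2)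
      (fun _ _ => Finset.sum_nonneg fun _ _ => by positivity) (Finset.mem_univ i))

theorem frobenius_norm_le_of_entry_le {M : Matrix (Fin d) (Fin d) 𝕜} {c : ℝ} (hc : 0 ≤ c)
    (h : ∀ i j, ‖M i j‖ ≤ c) : ‖M‖ ≤ d * c := by
  rw [Matrix.frobenius_norm_def, ← Real.sqrt_eq_rpow]
  refine Real.sqrt_le_iff.2 ⟨by positivity, ?_⟩
  simp only [Real.rpow_two]
  calc ∑ i, ∑ j, ‖M i j‖ ^ 2 ≤ ∑ _i : Fin d, ∑ _j : Fin d, c ^ 2 :=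
        Finset.sum_le_sum fun i _ => Finset.sum_le_sum fun j _ => by gcongr; exact h i j
    _ = (d * c) ^ 2 := by simp; ring

theorem norm_trace_le_frobenius (M : Matrix (Fin d) (Fin d) 𝕜) : ‖M.trace‖ ≤ d * ‖M‖ := by
  rw [Matrix.trace]
  refine (norm_sum_le _ _).trans ?_
  refine (Finset.sum_le_sum fun i _ => norm_entry_le_frobenius M i i).trans (le_of_eq ?_)
  simp

theorem frobenius_norm_le_toCLM (A : Matrix (Fin d) (Fin d) ℝ) : ‖A‖ ≤ d * ‖toCLM A‖ := by
  refine frobenius_norm_le_of_entry_le (norm_nonneg _) fun i j => ?_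
  have h1 : A i j = (toCLM A (EuclideanSpace.single j 1)) i := by
    simp [toCLM, Matrix.ofLp_toEuclideanCLM]
  rw [h1]
  refine (PiLp.norm_apply_le _ i).trans (((toCLM A).le_opNorm _).trans (le_of_eq ?_))
  simp

theorem frobenius_norm_one_le : ‖(1 : Matrix (Fin d) (Fin d) 𝕜)‖ ≤ d := by
  have := frobenius_norm_le_of_entry_le (M := (1 : Matrix (Fin d) (Fin d) 𝕜)) zero_le_one
    fun i j => by rw [Matrix.one_apply]; split_ifs <;> simp
  simpa using this

end Norms

/-- The linear map `B ↦ B A + (B A)ᵀ`. -/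
def symmAction {R : Type*} [CommRing R] (A B : Matrix (Fin d) (Fin d) R) :
    Matrix (Fin d) (Fin d) R :=
  B * A + (B * A).transpose

theorem symmAction_sub {R : Type*} [CommRing R] (A B B' : Matrix (Fin d) (Fin d) R) :
    symmAction A (B - B') = symmAction A B - symmAction A B' := by
  simp only [symmAction, Matrix.sub_mul, Matrix.transpose_sub]
  abel

theorem symmAction_smul {R : Type*} [CommRing R] (A B : Matrix (Fin d) (Fin d) R) (c : R) :
    symmAction A (c • B) = c • symmAction A B := by
  simp only [symmAction, Matrix.smul_mul, Matrix.transpose_smul, smul_add]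

theorem isSymm_symmAction {R : Type*} [CommRing R] (A B : Matrix (Fin d) (Fin d) R) :
    (symmAction A B).transpose = symmAction A B := by
  simp only [symmAction, Matrix.transpose_add, Matrix.transpose_transpose]
  abel

theorem trace_symmAction {R : Type*} [CommRing R] (A B : Matrix (Fin d) (Fin d) R) :
    (symmAction A B).trace = 2 * (B * A).trace := by
  rw [symmAction, Matrix.trace_add, Matrix.trace_transpose]
  ring

theorem norm_symmAction_le {𝕜 : Type*} [RCLike 𝕜] (A B : Matrix (Fin d) (Fin d) 𝕜) :
    ‖symmAction A B‖ ≤ 2 * (‖B‖ * ‖A‖) := by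
  refine (norm_add_le _ _).trans ?_
  rw [Matrix.frobenius_norm_transpose]
  linarith [Matrix.frobenius_norm_mul B A]

/-- For small `A` the moment problem has a solution `1 + X` with `X` small and traceless. It is
obtained as a fixed point: the trace of the equation determines `β` in terms of `X`. The constant
`8 (d + 1) (d + 2)` is not optimal; `d + 1` bounds the Frobenius norm of `1 + X`. -/
theorem exists_traceless_perturbation (hd : 2 ≤ d) {K r : ℝ} (hK : 0 < K) (hr0 : 0 < r)
    (hr1 : r ≤ 1) {A : Matrix (Fin d) (Fin d) ℝ}
    (hA : 8 * ((d + 1) * (d + 2)) * ‖A‖ ≤ K * r) :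
    ∃ (X : Matrix (Fin d) (Fin d) ℝ) (β : ℝ), ‖X‖ ≤ r ∧ X.IsSymm ∧ X.trace = 0 ∧
      |β| ≤ (d + 1) * ‖A‖ ∧ (2 * β) • (1 + X) + symmAction A (1 + X) + K • X = 0 := by
  have hd2 : (2 : ℝ) ≤ d := by exact_mod_cast hd
  set a := ‖A‖ with ha
  have ha0 : 0 ≤ a := norm_nonneg A
  let b : Matrix (Fin d) (Fin d) ℝ → ℝ := fun X => -((1 + X) * A).trace / d
  let G : Matrix (Fin d) (Fin d) ℝ → Matrix (Fin d) (Fin d) ℝ := fun X =>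
    -(K⁻¹ • (symmAction A (1 + X) + (2 * b X) • (1 + X)))
  have hone : ∀ X : Matrix (Fin d) (Fin d) ℝ, ‖X‖ ≤ r → ‖1 + X‖ ≤ d + 1 := fun X hX =>
    (norm_add_le _ _).trans (add_le_add frobenius_norm_one_le (hX.trans hr1))
  have htr : ∀ M : Matrix (Fin d) (Fin d) ℝ, |-(M * A).trace / d| ≤ ‖M‖ * a := fun M => by
    rw [abs_div, abs_neg, abs_of_pos (by linarith : (0 : ℝ) < d), div_le_iff₀ (by linarith)]
    have h1 := norm_trace_le_frobenius (M * A)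
    rw [Real.norm_eq_abs] at h1
    have h2 := Matrix.frobenius_norm_mul M A
    nlinarith
  have hb : ∀ X, ‖X‖ ≤ r → |b X| ≤ (d + 1) * a := fun X hX =>
    (htr (1 + X)).trans (by gcongr; exact hone X hX)
  have hbsub : ∀ X Y, |b X - b Y| ≤ ‖X - Y‖ * a := fun X Y => by
    have : b X - b Y = -((X - Y) * A).trace / d := by
      simp only [b, add_mul, sub_mul, Matrix.trace_add, Matrix.trace_sub]
      ring
    rw [this]
    exact htr _
  have hmaps : Set.MapsTo G (Metric.closedBall 0 r) (Metric.closedBall 0 r) := by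
    intro X hX
    rw [mem_closedBall_zero_iff] at hX ⊢
    have h1 := hone X hX
    have h2 := hb X hX
    have h3 := norm_symmAction_le A (1 + X)
    simp only [G]
    rw [norm_neg, norm_smul, norm_inv, Real.norm_of_nonneg hK.le, inv_mul_le_iff₀ hK]
    refine (norm_add_le _ _).trans ?_
    rw [norm_smul, Real.norm_eq_abs, abs_mul, abs_two]
    calc ‖symmAction A (1 + X)‖ + 2 * |b X| * ‖1 + X‖
        ≤ 2 * ((d + 1) * a) + 2 * ((d + 1) * a) * (d + 1) := by
          refine add_le_add (h3.trans ?_) ?_ <;> gcongr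
      _ ≤ 8 * ((d + 1) * (d + 2)) * a := by nlinarith [mul_nonneg ha0 (by linarith : (0 : ℝ) ≤ d)]
      _ ≤ K * r := hA
  have hlip : ∀ X ∈ Metric.closedBall (0 : Matrix (Fin d) (Fin d) ℝ) r,
      ∀ Y ∈ Metric.closedBall (0 : Matrix (Fin d) (Fin d) ℝ) r,
      dist (G X) (G Y) ≤ ((1 / 2 : NNReal) : ℝ) * dist X Y := by
    intro X hX Y hY
    rw [mem_closedBall_zero_iff] at hX hY
    have hsub : G X - G Y = -(K⁻¹ • (symmAction A (X - Y) + ((2 * b X) • (X - Y) +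
        (2 * (b X - b Y)) • (1 + Y)))) := by
      have h1 : symmAction A (X - Y) = symmAction A (1 + X) - symmAction A (1 + Y) := by
        rw [← symmAction_sub, add_sub_add_left_eq_sub]
      rw [h1]
      simp only [G]
      module
    rw [dist_eq_norm, dist_eq_norm, hsub, norm_neg, norm_smul, norm_inv,
      Real.norm_of_nonneg hK.le, inv_mul_le_iff₀ hK]
    have h1 := norm_symmAction_le A (X - Y)
    have h2 : ‖(2 * b X) • (X - Y)‖ ≤ 2 * ((d + 1) * a) * ‖X - Y‖ := by
      rw [norm_smul, Real.norm_eq_abs, abs_mul, abs_two]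
      gcongr
      exact hb X hX
    have h3 : ‖(2 * (b X - b Y)) • (1 + Y)‖ ≤ 2 * (‖X - Y‖ * a) * (d + 1) := by
      rw [norm_smul, Real.norm_eq_abs, abs_mul, abs_two]
      gcongr
      · exact hbsub X Y
      · exact hone Y hY
    have h4 : (8 * ((d + 1) * (d + 2)) * a) * ‖X - Y‖ ≤ K * ‖X - Y‖ := by
      gcongr
      exact hA.trans (by nlinarith)
    have h5 : 0 ≤ a * ‖X - Y‖ := by positivity
    have h6 := norm_add_le (symmAction A (X - Y)) ((2 * b X) • (X - Y) +
      (2 * (b X - b Y)) • (1 + Y))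
    have h7 := norm_add_le ((2 * b X) • (X - Y)) ((2 * (b X - b Y)) • (1 + Y))
    have h8 : (2 * (d + 1) + 2 * (d + 1) + 2) * (a * ‖X - Y‖) ≤
        (4 * ((d + 1) * (d + 2))) * (a * ‖X - Y‖) := by
      gcongr
      nlinarith
    push_cast
    linarith
  have hcw : ContractingWith (1 / 2 : NNReal) (hmaps.restrict G _ _) := by
    refine ⟨by rw [← NNReal.coe_lt_coe]; norm_num, LipschitzWith.of_dist_le_mul fun X Y => ?_⟩
    exact hlip X X.2 Y Y.2
  obtain ⟨X, hXr, hfix, -⟩ := ContractingWith.exists_fixedPoint'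
    Metric.isClosed_closedBall.isComplete hmaps hcw (Metric.mem_closedBall_self hr0.le)
    (edist_ne_top _ _)
  rw [mem_closedBall_zero_iff] at hXr
  have hbX := hb X hXr
  have heq : (2 * b X) • (1 + X) + symmAction A (1 + X) + K • X = 0 := by
    have h1 : X = -(K⁻¹ • (symmAction A (1 + X) + (2 * b X) • (1 + X))) := hfix.symm
    have h2 : K • X = -(symmAction A (1 + X) + (2 * b X) • (1 + X)) := by
      conv_lhs => rw [h1]
      rw [smul_neg, smul_smul, mul_inv_cancel₀ hK.ne', one_smul]
    rw [h2]
    abel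
  have hKb : 0 < K + 2 * b X := by
    have h1 := (abs_le.1 hbX).1
    have h2 : 8 * ((d + 1) * (d + 2)) * a ≤ K := hA.trans (by nlinarith)
    nlinarith [mul_nonneg ha0 (by linarith : (0 : ℝ) ≤ d)]
  -- The equation exhibits a nonzero multiple of `X` as a symmetric matrix, and its trace is a
  -- nonzero multiple of the trace of `X`.
  refine ⟨X, b X, hXr, ?_, ?_, hbX, heq⟩
  · have h1 : (K + 2 * b X) • X = -(symmAction A (1 + X) + (2 * b X) • 1) := by
      rw [← sub_eq_zero, ← heq]
      module
    have h2 := congrArg Matrix.transpose h1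
    rw [Matrix.transpose_neg, Matrix.transpose_add, isSymm_symmAction, Matrix.transpose_smul,
      Matrix.transpose_smul, Matrix.transpose_one, ← h1] at h2
    exact smul_right_injective _ hKb.ne' h2
  · have h1 := congrArg Matrix.trace heq
    simp only [Matrix.trace_add, Matrix.trace_smul, trace_symmAction, Matrix.trace_one,
      Fintype.card_fin, smul_eq_mul, Matrix.trace_zero] at h1
    have h2 : ((1 + X) * A).trace = -(b X * d) := by
      simp only [b]
      field_simp
    rw [h2] at h1
    have h3 : (K + 2 * b X) * X.trace = 0 := by linarith
    exact (mul_eq_zero.1 h3).resolve_left hKb.ne'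

/-- Uniqueness modulo the dominant eigenvector: the traceless part of a generalized solution of
the moment problem vanishes when the spectral parameter is not too far to the left. -/
theorem eq_zero_of_traceless (hd : 2 ≤ d) {K : ℝ} (hK : 0 < K)
    {A N Y : Matrix (Fin d) (Fin d) ℂ} (hA : 8 * ((d + 1) * (d + 2)) * ‖A‖ ≤ K)
    (hN : ‖N‖ ≤ d + 1) (hNtr : N.trace = d) (hY : Y.trace = 0) {μ c : ℂ}
    (hμ : -(K / 4) ≤ μ.re) (h : (2 * μ) • Y + symmAction A Y + (K : ℂ) • Y = c • N) : Y = 0 := by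
  have hd2 : (2 : ℝ) ≤ d := by exact_mod_cast hd
  have ha0 := norm_nonneg A
  have hy0 := norm_nonneg Y
  have htr := congrArg Matrix.trace h
  simp only [Matrix.trace_add, Matrix.trace_smul, trace_symmAction, hY, hNtr, smul_eq_mul,
    mul_zero, zero_add, add_zero] at htr
  -- The trace of the equation bounds `c` by the small quantity `‖Y‖ ‖A‖`.
  have hc : ‖c‖ ≤ 2 * (‖Y‖ * ‖A‖) := by
    have h1 := congrArg norm htr
    rw [norm_mul, norm_mul, Complex.norm_natCast, Complex.norm_ofNat] at h1
    have h2 := norm_trace_le_frobenius (Y * A)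
    have h3 := Matrix.frobenius_norm_mul Y A
    have h4 : ‖c‖ * d ≤ 2 * (‖Y‖ * ‖A‖) * d := by rw [← h1]; nlinarith
    exact le_of_mul_le_mul_right h4 (by linarith)
  have hsolve : (2 * μ + K) • Y = c • N - symmAction A Y := by
    rw [← h]
    module
  have hnorm : ‖2 * μ + K‖ * ‖Y‖ ≤ ‖c‖ * (d + 1) + 2 * (‖Y‖ * ‖A‖) := by
    rw [← norm_smul, hsolve]
    refine (norm_sub_le _ _).trans (add_le_add ?_ (norm_symmAction_le A Y))
    rw [norm_smul]
    gcongr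
  have hre : K / 2 ≤ ‖2 * μ + K‖ := by
    refine le_trans ?_ ((le_abs_self _).trans (Complex.abs_re_le_norm _))
    simp
    linarith
  have h1 : K / 2 * ‖Y‖ ≤ 2 * (d + 2) * ‖A‖ * ‖Y‖ := by
    have h2 : K / 2 * ‖Y‖ ≤ ‖2 * μ + K‖ * ‖Y‖ := by gcongr
    have h3 : ‖c‖ * ((d : ℝ) + 1) ≤ 2 * (‖Y‖ * ‖A‖) * (d + 1) := by gcongr
    linarith
  have h2 : 2 * (d + 2) * ‖A‖ * ‖Y‖ ≤ K / 4 * ‖Y‖ := by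
    gcongr
    nlinarith [mul_nonneg ha0 (by linarith : (0 : ℝ) ≤ d)]
  have h3 : ‖Y‖ ≤ 0 := by
    by_contra! h4
    nlinarith
  exact norm_le_zero_iff.1 h3

end MomentProblem

/-! ### Spectral properties of the moment operator -/

section Spectral

open scoped Matrix.Norms.Frobenius

variable {d : ℕ} {g : ℝ → ℝ}

theorem momentMap_apply (A : Matrix (Fin d) (Fin d) ℝ) (B : Matrix (Fin d) (Fin d) ℂ) :
    momentMap g A B = symmAction (A.map Complex.ofReal) B +
      ((kernelQ d g * d / (2 * (d - 1)) : ℝ) : ℂ) • (B - (B.trace / d) • 1) := by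
  push_cast
  rfl

theorem momentMap_of_trace_eq_zero (A : Matrix (Fin d) (Fin d) ℝ)
    {Y : Matrix (Fin d) (Fin d) ℂ} (hY : Y.trace = 0) :
    momentMap g A Y = symmAction (A.map Complex.ofReal) Y +
      ((kernelQ d g * d / (2 * (d - 1)) : ℝ) : ℂ) • Y := by
  rw [momentMap_apply, hY, zero_div, zero_smul, sub_zero]

/-- A real solution of the moment problem is a solution in the sense of `SolvesMomentProblem`. -/
theorem solvesMomentProblem_of_real {A N : Matrix (Fin d) (Fin d) ℝ} {β : ℝ}
    (h : (2 * β) • N + symmAction A N +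
      (kernelQ d g * d / (2 * (d - 1))) • (N - (N.trace / d) • 1) = 0) :
    SolvesMomentProblem g A (β : ℂ) (N.map Complex.ofReal) := by
  rw [SolvesMomentProblem, momentMap_apply]
  have htr : (N.map Complex.ofReal).trace = (N.trace : ℂ) := by
    simp [Matrix.trace]
  rw [htr]
  ext i j
  have h1 := congrArg (fun x : ℝ => (x : ℂ)) (congrFun (congrFun h i) j)
  simp only [symmAction, Matrix.add_apply, Matrix.smul_apply, Matrix.sub_apply, Matrix.mul_apply,
    Matrix.transpose_apply, Matrix.map_apply, Matrix.one_apply, Matrix.zero_apply,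
    smul_eq_mul] at h1 ⊢
  have hite : ((if i = j then (1 : ℝ) else 0 : ℝ) : ℂ) = if i = j then 1 else 0 := by
    split_ifs <;> simp
  push_cast at h1 ⊢
  rw [hite] at h1
  refine Eq.trans ?_ h1
  ring

variable {A : Matrix (Fin d) (Fin d) ℝ} {β : ℝ} {N : Matrix (Fin d) (Fin d) ℂ}

/-- The smallness condition under which the dominant eigenvector `N`, normalized to have trace
`d`, controls the spectrum of the moment operator to the right of `β`. -/
structure IsDominantPair (g : ℝ → ℝ) (A : Matrix (Fin d) (Fin d) ℝ) (β : ℝ)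
    (N : Matrix (Fin d) (Fin d) ℂ) : Prop where
  two_le : 2 ≤ d
  coeff_pos : 0 < kernelQ d g * d / (2 * (d - 1))
  small : 8 * ((d + 1) * (d + 2)) * ‖A.map Complex.ofReal‖ ≤ kernelQ d g * d / (2 * (d - 1))
  norm_le : ‖N‖ ≤ d + 1
  trace_eq : N.trace = d
  neg_le : -(kernelQ d g * d / (2 * (d - 1)) / 4) ≤ β
  symm : N.IsSymm
  solves : SolvesMomentProblem g A (β : ℂ) N

theorem IsDominantPair.ne_zero (h : IsDominantPair g A β N) : N ≠ 0 := by
  rintro rfl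
  have := h.trace_eq
  rw [Matrix.trace_zero] at this
  have h2 := h.two_le
  exact absurd (Nat.cast_eq_zero.1 this.symm) (by omega)

/-- To the right of `β`, equations `(momentMap + 2 μ) B = c N` have only the multiples of `N` as
solutions. This excludes both further eigenvalues and a Jordan block at `β`. -/
theorem IsDominantPair.exists_eq_smul (h : IsDominantPair g A β N)
    {B : Matrix (Fin d) (Fin d) ℂ} {μ c : ℂ} (hμ : β ≤ μ.re)
    (hB : (2 * μ) • B + momentMap g A B = c • N) : ∃ b : ℂ, B = b • N := by
  have hd0 : (d : ℂ) ≠ 0 := by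
    have := h.two_le
    exact Nat.cast_ne_zero.2 (by omega)
  refine ⟨B.trace / d, ?_⟩
  set b := B.trace / d with hb
  have htr : (B - b • N).trace = 0 := by
    rw [Matrix.trace_sub, Matrix.trace_smul, h.trace_eq, smul_eq_mul, hb, div_mul_cancel₀ _ hd0,
      sub_self]
  have hN : momentMap g A N = -((2 * (β : ℂ)) • N) := eq_neg_of_add_eq_zero_right h.solves
  have hBm : momentMap g A B = c • N - (2 * μ) • B := by rw [← hB]; abel
  refine sub_eq_zero.1 (eq_zero_of_traceless h.two_le h.coeff_pos h.small h.norm_le h.trace_eq htr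
    (μ := μ) (c := c + 2 * b * (β - μ)) (h.neg_le.trans hμ) ?_)
  rw [add_assoc, ← momentMap_of_trace_eq_zero A htr, map_sub, map_smul, hN, hBm]
  module

theorem IsDominantPair.isMomentEigenvalue (h : IsDominantPair g A β N) :
    IsMomentEigenvalue g A (β : ℂ) :=
  ⟨N, h.symm, h.ne_zero, h.solves⟩

theorem IsDominantPair.re_lt (h : IsDominantPair g A β N) {μ : ℂ}
    (hμ : IsMomentEigenvalue g A μ) (hne : μ ≠ β) : μ.re < β := by
  by_contra! hle
  obtain ⟨B, -, hB0, hB⟩ := hμ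
  obtain ⟨b, rfl⟩ := h.exists_eq_smul (c := 0) hle (by rw [zero_smul]; exact hB)
  have h1 : (2 * (μ - β) * b) • N = 0 := by
    have h2 := hB
    rw [SolvesMomentProblem, map_smul, eq_neg_of_add_eq_zero_right h.solves] at h2
    rw [← h2]
    module
  have h3 := (smul_eq_zero.1 h1).resolve_right h.ne_zero
  have hb : b ≠ 0 := fun hb => hB0 (by rw [hb, zero_smul])
  have h4 : μ - β ≠ 0 := sub_ne_zero.2 hne
  exact (mul_ne_zero (mul_ne_zero two_ne_zero h4) hb) h3

/-- Generalized eigenvectors at `β` are multiples of `N`: each application of `momentOperator - β`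
is removed by `IsDominantPair.exists_eq_smul`. -/
theorem IsDominantPair.mem_span_of_pow_apply_eq_zero (h : IsDominantPair g A β N) (n : ℕ)
    (B : symmMatrices d) (hB : ((momentOperator g A - (β : ℂ) • 1) ^ n) B = 0) :
    B ∈ Submodule.span ℂ {(⟨N, h.symm⟩ : symmMatrices d)} := by
  induction n generalizing B with
  | zero =>
    rw [pow_zero, Module.End.one_apply] at hB
    rw [hB]
    exact Submodule.zero_mem _
  | succ n ih =>
    rw [pow_succ, Module.End.mul_apply] at hB
    obtain ⟨c, hc⟩ := Submodule.mem_span_singleton.1 (ih _ hB)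
    have hc' : c • N = -(1 / 2 : ℂ) • momentMap g A B - (β : ℂ) • (B : Matrix _ _ ℂ) :=
      congrArg Subtype.val hc
    obtain ⟨b, hb⟩ := h.exists_eq_smul (B := B) (μ := β) (c := -2 * c) (by simp) (by
      rw [mul_smul (-2 : ℂ), hc']
      module)
    exact Submodule.mem_span_singleton.2 ⟨b, Subtype.ext hb.symm⟩

theorem IsDominantPair.isSimple (h : IsDominantPair g A β N) :
    IsSimpleMomentEigenvalue g A (β : ℂ) := by
  refine ⟨h.isMomentEigenvalue, ?_⟩
  have hspan : (momentOperator g A).maxGenEigenspace (β : ℂ) =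
      Submodule.span ℂ {(⟨N, h.symm⟩ : symmMatrices d)} := by
    refine le_antisymm (fun B hB => ?_) ((Submodule.span_singleton_le_iff_mem _ _).2 ?_)
    · obtain ⟨n, hn⟩ := (Module.End.mem_maxGenEigenspace _ _ _).1 hB
      exact h.mem_span_of_pow_apply_eq_zero n B hn
    · refine (Module.End.mem_maxGenEigenspace _ _ _).2 ⟨1, ?_⟩
      rw [pow_one, LinearMap.sub_apply, sub_eq_zero]
      exact (momentOperator_apply_eq_iff g A β ⟨N, h.symm⟩).2 h.solves
  rw [hspan]
  exact finrank_span_singleton fun h0 => h.ne_zero (congrArg Subtype.val h0)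

end Spectral

section DominantEigenvector

open scoped Matrix.Norms.Frobenius

variable {d : ℕ} {g : ℝ → ℝ}

/-- The entries of `X` are bounded by `‖X‖`, so its quadratic form is bounded by `d ‖X‖` times the
square of the Euclidean norm. -/
theorem posDef_one_add {X : Matrix (Fin d) (Fin d) ℝ} (hs : X.IsSymm)
    (hX : d * ‖X‖ < 1) : (1 + X).PosDef := by
  refine Matrix.PosDef.of_dotProduct_mulVec_pos ?_ fun x hx => ?_
  · rw [Matrix.IsHermitian, Matrix.conjTranspose_eq_transpose_of_trivial]
    exact (Matrix.isSymm_one).add hs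
  · have hpos : 0 < ∑ i, x i ^ 2 := by
      obtain ⟨i, hi⟩ := Function.ne_iff.1 hx
      exact Finset.sum_pos' (fun _ _ => sq_nonneg _)
        ⟨i, Finset.mem_univ i, by have : x i ≠ 0 := hi; positivity⟩
    have hX' : |∑ i, ∑ j, X i j * (x i * x j)| ≤ d * ‖X‖ * ∑ i, x i ^ 2 := by
      calc |∑ i, ∑ j, X i j * (x i * x j)|
          ≤ ∑ i, ∑ j, |X i j * (x i * x j)| :=
            (Finset.abs_sum_le_sum_abs _ _).trans
              (Finset.sum_le_sum fun i _ => Finset.abs_sum_le_sum_abs _ _)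
        _ ≤ ∑ i, ∑ j, ‖X‖ * (1 / 2 * (x i ^ 2 + x j ^ 2)) := by
            refine Finset.sum_le_sum fun i _ => Finset.sum_le_sum fun j _ => ?_
            rw [abs_mul]
            refine mul_le_mul (norm_entry_le_frobenius X i j) ?_ (abs_nonneg _) (norm_nonneg _)
            rw [abs_le]
            constructor <;> nlinarith [sq_nonneg (x i + x j), sq_nonneg (x i - x j)]
        _ = d * ‖X‖ * ∑ i, x i ^ 2 := by
            simp only [← Finset.mul_sum, Finset.sum_add_distrib, Finset.sum_const,
              Finset.card_univ, Fintype.card_fin, nsmul_eq_mul]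
            ring
    have hexp : star x ⬝ᵥ (1 + X).mulVec x =
        ∑ i, x i ^ 2 + ∑ i, ∑ j, X i j * (x i * x j) := by
      rw [star_trivial, Matrix.add_mulVec, Matrix.one_mulVec, dotProduct_add]
      simp only [dotProduct, Matrix.mulVec, Finset.mul_sum]
      congr 1
      · exact Finset.sum_congr rfl fun i _ => by ring
      · exact Finset.sum_congr rfl fun i _ => Finset.sum_congr rfl fun j _ => by ring
    rw [hexp]
    have := (abs_le.1 hX').1
    nlinarith

/-- The dominant eigenvalue of the moment problem for a small deformation matrix, and its
normalized positive definite eigenvector. -/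
theorem exists_dominant_eigenvector (hd : 2 ≤ d) (hq : 0 < kernelQ d g) {δ : ℝ} (hδ : 0 < δ) :
    ∃ ε₀ : ℝ, 0 < ε₀ ∧ ε₀ ≤ δ ∧ ∀ A : Matrix (Fin d) (Fin d) ℝ, ‖toCLM A‖ ≤ ε₀ →
      ∃ (β : ℝ) (N : Matrix (Fin d) (Fin d) ℝ), |β| ≤ δ ∧ N.IsSymm ∧
        (2 * β) • N + symmAction A N +
          (kernelQ d g * d / (2 * (d - 1))) • (N - (N.trace / d) • 1) = 0 ∧
        IsSimpleMomentEigenvalue g A (β : ℂ) ∧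
        (∀ μ : ℂ, IsMomentEigenvalue g A μ → μ ≠ (β : ℂ) → μ.re < β) ∧
        N.PosDef ∧ (1 / (d : ℝ)) * (N.transpose * N).trace = 1 := by
  have hd2 : (2 : ℝ) ≤ d := by exact_mod_cast hd
  have hd0 : (0 : ℝ) < d := by linarith
  set K := kernelQ d g * d / (2 * (d - 1)) with hKdef
  have hK : 0 < K := div_pos (mul_pos hq hd0) (by linarith)
  -- A perturbation of Frobenius norm at most `r` keeps the identity positive definite.
  set r : ℝ := 1 / (2 * d) with hr
  have hr0 : 0 < r := by positivity
  have hr1 : r ≤ 1 := by rw [hr, div_le_one (by positivity)]; linarith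
  set D : ℝ := 8 * ((d + 1) * (d + 2)) with hD
  have hD0 : 0 < D := by positivity
  refine ⟨min (K * r / (D * d)) (δ / ((d + 1) * d)), by positivity, ?_, fun A hA => ?_⟩
  · refine (min_le_right _ _).trans (div_le_self hδ.le ?_)
    nlinarith
  have hAF := frobenius_norm_le_toCLM A
  have hA1 : D * ‖A‖ ≤ K * r := by
    have h1 := (le_div_iff₀ (by positivity)).1 (hA.trans (min_le_left _ _))
    nlinarith
  have hA2 : (d + 1) * ‖A‖ ≤ δ := by
    have h1 := (le_div_iff₀ (by positivity)).1 (hA.trans (min_le_right _ _))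
    nlinarith
  obtain ⟨X, β, hXr, hXs, hXt, hβ, heq⟩ := exists_traceless_perturbation hd hK hr0 hr1 hA1
  have htr : (1 + X).trace = d := by simp [Matrix.trace_add, hXt]
  have hsymm : (1 + X).IsSymm := (Matrix.isSymm_one).add hXs
  have hreal : (2 * β) • (1 + X) + symmAction A (1 + X) +
      K • ((1 + X) - ((1 + X).trace / d) • 1) = 0 := by
    rw [htr, div_self hd0.ne', one_smul, add_sub_cancel_left, heq]
  have hmap : ∀ M : Matrix (Fin d) (Fin d) ℝ, ‖M.map Complex.ofReal‖ = ‖M‖ := fun M =>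
    Matrix.frobenius_norm_map_eq M _ fun x => Complex.norm_real x
  have hpair : IsDominantPair g A β ((1 + X).map Complex.ofReal) :=
    { two_le := hd
      coeff_pos := hK
      small := by rw [hmap]; exact hA1.trans (by nlinarith)
      norm_le := by
        rw [hmap]
        exact (norm_add_le _ _).trans (add_le_add frobenius_norm_one_le (hXr.trans hr1))
      trace_eq := by
        have : ((1 + X).map Complex.ofReal).trace = ((1 + X).trace : ℂ) := by
          simp [Matrix.trace]
        rw [this, htr, Complex.ofReal_natCast]
      neg_le := by
        have h1 := (abs_le.1 hβ).1
        have h2 : (d + 1) * ‖A‖ ≤ K / 4 := by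
          have h3 : D * ‖A‖ ≤ K := hA1.trans (by nlinarith)
          rw [hD] at h3
          nlinarith [mul_nonneg (norm_nonneg A) hd0.le]
        linarith
      symm := hsymm.map _
      solves := solvesMomentProblem_of_real hreal }
  have hpos : (1 + X).PosDef := posDef_one_add hXs (by
    have : d * ‖X‖ ≤ d * r := by gcongr
    have h2 : d * r = 1 / 2 := by rw [hr]; field_simp
    linarith)
  set t := ((1 + X).transpose * (1 + X)).trace with ht
  have ht0 : 0 < t := by
    rw [ht, ← Matrix.conjTranspose_eq_transpose_of_trivial]
    refine lt_of_le_of_ne (Matrix.posSemidef_conjTranspose_mul_self _).trace_nonneg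
      fun h0 => ?_
    rw [Matrix.trace_conjTranspose_mul_self_eq_zero_iff.1 h0.symm, Matrix.trace_zero] at htr
    exact hd0.ne htr
  have hs : 0 < Real.sqrt (d / t) := Real.sqrt_pos.2 (by positivity)
  refine ⟨β, Real.sqrt (d / t) • (1 + X), hβ.trans hA2, hsymm.smul _, ?_, hpair.isSimple,
    fun μ hμ hne => hpair.re_lt hμ hne, hpos.smul hs, ?_⟩
  · rw [symmAction_smul, Matrix.trace_smul, smul_eq_mul]
    have h1 := congrArg (fun M => Real.sqrt (d / t) • M) hreal
    simp only [smul_zero] at h1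
    rw [← h1, mul_div_assoc, mul_smul]
    module
  · rw [Matrix.transpose_smul, Matrix.smul_mul, Matrix.mul_smul, smul_smul, Matrix.trace_smul,
      ← ht, Real.mul_self_sqrt (by positivity), smul_eq_mul]
    field_simp

/-- The matrix identity linking the moment problem to the quadratic part of the gain operator. -/
theorem gainMatrix_eq {A N : Matrix (Fin d) (Fin d) ℝ} {β : ℝ} (hN : N.IsSymm)
    (h : (2 * β) • N + symmAction A N +
      (kernelQ d g * d / (2 * (d - 1))) • (N - (N.trace / d) • 1) = 0) :
    gainMatrix g N = N + (N * (A + β • 1) + (N * (A + β • 1)).transpose) := by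
  have h1 : N * (A + β • 1) + (N * (A + β • 1)).transpose = symmAction A N + (2 * β) • N := by
    rw [Matrix.mul_add, Matrix.mul_smul, Matrix.mul_one, Matrix.transpose_add,
      Matrix.transpose_smul, hN.eq, symmAction]
    module
  rw [h1, gainMatrix, sub_eq_iff_eq_add, eq_comm, ← sub_eq_zero, ← h]
  module

end DominantEigenvector

end MaxwellDeformation

theorem mainTheorem3 (d : ℕ) (hd : 2 ≤ d) (g : ℝ → ℝ)
    (hg : MaxwellDeformation.IsCollisionKernel d g) (p : ℝ) (hp : 2 < p) :
    ∃ ε₀ : ℝ, 0 < ε₀ ∧ ∀ A : Matrix (Fin d) (Fin d) ℝ,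
      ‖MaxwellDeformation.toCLM A‖ ≤ ε₀ →
      ∃ (β : ℝ) (N : Matrix (Fin d) (Fin d) ℝ),
        (MaxwellDeformation.IsSimpleMomentEigenvalue g A (β : ℂ) ∧
          (∀ μ : ℂ, MaxwellDeformation.IsMomentEigenvalue g A μ → μ ≠ (β : ℂ) → μ.re < β) ∧
          MaxwellDeformation.SolvesMomentProblem g A (β : ℂ) (N.map Complex.ofReal) ∧
          N.PosDef ∧
          (1 / (d : ℝ)) * (N.transpose * N).trace = 1) ∧
        (p ≤ 4 →
          (MaxwellDeformation.classF p (N.map Complex.ofReal)).Nonempty ∧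
          ∃! Ψ : MaxwellDeformation.E d → ℂ,
            Ψ ∈ MaxwellDeformation.classF p (N.map Complex.ofReal) ∧
            MaxwellDeformation.IsStationaryProfile g A β Ψ) := by
  open MaxwellDeformation in
  have hμ := contractionFactor_lt_one hd hg hp
  -- `δ` is chosen so that `‖A + β‖ ≤ 2 δ` keeps the contraction factor of the fixed point map
  -- below one.
  obtain ⟨ε₀, hε0, hεδ, h⟩ := exists_dominant_eigenvector hd (kernelQ_pos hd hg)
    (δ := (1 - contractionFactor d g p) / (4 * p)) (div_pos (by linarith) (by linarith))
  refine ⟨ε₀, hε0, fun A hA => ?_⟩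
  obtain ⟨β, N, hβ, hsymm, hreal, hsimple, hdom, hpos, hnorm⟩ := h A hA
  refine ⟨β, N, ⟨hsimple, hdom, solvesMomentProblem_of_real hreal, hpos, hnorm⟩, fun h4 =>
    ⟨classF_nonempty hpos.posSemidef hp.le h4, ?_⟩⟩
  refine existsUnique_stationaryProfile hd hg hp h4 hpos.posSemidef hsymm
    (gainMatrix_eq hsymm hreal) ?_
  have hone : ‖toCLM (1 : Matrix (Fin d) (Fin d) ℝ)‖ ≤ 1 := by
    rw [toCLM, map_one]
    exact ContinuousLinearMap.norm_id_le
  have hB : ‖toCLM (A + β • 1)‖ ≤ 2 * ((1 - contractionFactor d g p) / (4 * p)) := by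
    rw [toCLM, map_add, map_smul]
    refine (norm_add_le _ _).trans ?_
    have h1 : ‖β • toCLM (1 : Matrix (Fin d) (Fin d) ℝ)‖ ≤ |β| := by
      rw [norm_smul, Real.norm_eq_abs]
      exact mul_le_of_le_one_right (abs_nonneg _) hone
    have h2 := hA.trans hεδ
    linarith
  have h3 : p * ‖toCLM (A + β • 1)‖ ≤ (1 - contractionFactor d g p) / 2 := by
    calc p * ‖toCLM (A + β • 1)‖
        ≤ p * (2 * ((1 - contractionFactor d g p) / (4 * p))) := by gcongr
      _ = (1 - contractionFactor d g p) / 2 := by field_simp; ring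
  linarith
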